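/- **Theorem 6.2 (Cancellations for sums of embedded maps obtained from pinchings of a blue face).** *Setting.* A *lattice loop* is a closed nearest-neighbour path of positive length in $\mathbb Z^d$; a *plaquette* is an oriented simple loop of length four. Let $s=(\ell_1,\dots,\ell_n)$ be a string of lattice loops and $K$ a function from plaquettes to $\mathbb N$. A *planar embedded map* with boundary $s$ and plaquette assignment $K$ is a collection $M=(m,\psi)$ of $n$ connected planar maps $m_1,\dots,m_n$ (finite multigraphs drawn on the sphere, all faces being open disks), together with a graph homomorphism $\psi$ from $m$ to $\mathbb Z^d$ and one distinguished *external* face in each $m_i$, such that: (i) the faces are coloured blue and yellow, every edge separates a blue face from a yellow one, and external faces are yellow; (ii) each blue face is sent by $\psi$ to a single unoriented lattice edge (so its degree is even); (iii) each internal yellow face, explored clockwise, is sent isomorphically to a plaquette, and exactly $K(p)$ of them are sent to $p$, for each plaquette $p$; (iv) the boundary of the external face of $m_i$, explored clockwise, is sent isomorphically to $\ell_i$, each boundary edge corresponding to a specified edge (position) of $\ell_i$. Maps are considered up to orientation-preserving homeomorphisms that respect $\psi$ and the correspondence in (iv). The map $M$ is *non-separable* if for every lattice edge $e$, deleting from the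 dual graph all (vertices corresponding to) blue faces sent to $e$ does not disconnect the dual graph of any component; otherwise it is *separable*. Denote by $\mathrm{BF}(M)$ the set of blue faces and put $$w_\infty(M)=\prod_{f\in \mathrm{BF}(M)} w_{\deg(f)/2},\qquad w_i=(-1)^{i-1}\,\mathrm{Cat}(i-1),\qquad \mathrm{Cat}(k)=\frac{(2k)!}{k!\,(k+1)!}.$$ *Pinchings.* Let $M$ be non-separable and $B$ a blue face of $M$ (its vertices are then pairwise distinct). For two distinct vertices $u,v$ of $B$ in the same partite class (i.e. with the same image under $\psi$), the pinching $\mathrm{pn}_{u,v}$ identifies $u$ and $v$ inside $B$, splitting $B$ into two blue faces. Two pinchings $\mathrm{pn}_{u,v}$, $\mathrm{pn}_{u',v'}$ of $B$ in opposite partite classes are *non feasible* together if after pinching $u,v$ the vertices $u',v'$ lie in two different blue faces. A (possibly empty) collection of pinchings of $B$ is *feasible* if it contains no such pair. Performing a feasible collection $\mathrm{Pn}$ identifies, inside $B$, the two vertices of each of its pinchings; if after pinching $u,v$ the vertices $u',v'$ of another pinching of the collection (then in the same partite class) lie in two different blue faces, all four vertices are identified together. The resulting embedded map is $\mathrm{Pn}(M)$;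 the collection is *valid* if $\mathrm{Pn}(M)$ is non-separable and *invalid* if it is separable. Let $\mathcal{VM}(M,B)$ be the set of all maps $\mathrm{Pn}(M)$ with $\mathrm{Pn}$ a valid feasible collection of pinchings of $B$. *Statement.* For every non-separable planar embedded map $M$ with boundary $s$ and plaquette assignment $K$, and every blue face $B$ of $M$, $$\sum_{M'\in\mathcal{VM}(M,B)} w_\infty(M')=\begin{cases}\displaystyle\prod_{f\in \mathrm{BF}(M)\setminus\{B\}} w_{\deg(f)/2}, & \text{if all feasible collections of pinchings of } B \text{ are valid},\\[2mm] 0, & \text{if at least one feasible collection of pinchings of } B \text{ is invalid}.\end{cases}$$ -/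

import Mathlib

open Equiv

namespace SurfaceSum

/-! ### The lattice -/

/-- The nearest-neighbour graph of the lattice `ℤ^d`. -/
def latticeGraph (d : ℕ) : SimpleGraph (Fin d → ℤ) where
  Adj u v := ∑ i, |u i - v i| = 1
  symm := ⟨fun u v h => by simpa only [abs_sub_comm] using h⟩
  loopless := ⟨fun u h => by simp at h⟩

/-- Oriented lattice edges; `e.symm` is the reversed edge and `e.edge` the unoriented one. -/
abbrev LatticeEdge (d : ℕ) := (latticeGraph d).Dart

/-- Lattice loops, written as a word starting at a chosen starting point. -/
abbrev LatticeLoop (d : ℕ) := Σ v : Fin d → ℤ, (latticeGraph d).Walk v v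

/-- Oriented plaquettes: simple loops of length four, as cyclic words of oriented edges. -/
def Plaquette (d : ℕ) :=
  {c : Cycle (LatticeEdge d) // ∃ (v : Fin d → ℤ) (p : (latticeGraph d).Walk v v),
    p.IsCycle ∧ p.length = 4 ∧ (p.darts : Cycle (LatticeEdge d)) = c}

/-! ### Cycles of permutations -/

/-- The set of cycles (orbits, fixed points included) of a permutation. -/
def Orbits {E : Type*} (f : Perm E) : Type _ := Quotient (Perm.SameCycle.setoid f)

namespace Orbits

variable {E : Type*} {f : Perm E}

/-- The cycle through `x`. -/
def mk (f : Perm E) (x : E) : Orbits f := Quotient.mk _ x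

theorem mk_eq_iff {x x' : E} : mk f x = mk f x' ↔ f.SameCycle x x' := Quotient.eq

/-- The number of elements of a cycle. -/
noncomputable def size (F : Orbits f) : ℕ := Nat.card {x : E // mk f x = F}

noncomputable instance [Finite E] : Fintype (Orbits f) :=
  @Fintype.ofFinite _ (inferInstanceAs (Finite (Quotient _)))

noncomputable instance : DecidableEq (Orbits f) := Classical.decEq _

end Orbits

/-- First return map of `f` to the classes of the equivalence relation `r`: the point `x` is sent
to the first of `f x, f (f x), …` that is equivalent to `x`. -/
noncomputable def firstReturn {E : Type*} (f : Perm E) (r : Setoid E) (x : E) : E :=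
  (f ^ sInf {k : ℕ | 0 < k ∧ r ((f ^ k) x) x}) x

theorem firstReturn_spec {E : Type*} [Finite E] (f : Perm E) (r : Setoid E) (x : E) :
    ∃ k : ℕ, 0 < k ∧ firstReturn f r x = (f ^ k) x ∧ r ((f ^ k) x) x ∧
      ∀ j, 0 < j → j < k → ¬ r ((f ^ j) x) x := by
  have hne : {k : ℕ | 0 < k ∧ r ((f ^ k) x) x}.Nonempty :=
    ⟨orderOf f, orderOf_pos f, by rw [pow_orderOf_eq_one]; exact r.refl _⟩
  refine ⟨_, (Nat.sInf_mem hne).1, rfl, (Nat.sInf_mem hne).2, fun j hj hlt h => ?_⟩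
  exact Nat.notMem_of_lt_sInf hlt ⟨hj, h⟩

theorem firstReturn_bijective {E : Type*} [Finite E] (f : Perm E) (r : Setoid E) :
    Function.Bijective (firstReturn f r) := by
  apply Finite.injective_iff_bijective.mp
  have key : ∀ (x x' : E) (k k' : ℕ), k < k' → 0 < k → r ((f ^ k) x) x →
      r ((f ^ k') x') x' → (f ^ k) x = (f ^ k') x' →
      (∀ j, 0 < j → j < k' → ¬ r ((f ^ j) x') x') → False := by
    intro x x' k k' hlt hk h h' heq hmin
    have hx : x = (f ^ (k' - k)) x' := by
      apply (f ^ k).injective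
      rw [heq, ← Perm.mul_apply, ← pow_add]
      congr 2
      omega
    refine hmin (k' - k) (by omega) (by omega) ?_
    rw [← hx]
    exact r.trans (r.symm h) (heq ▸ h')
  intro x x' hxx
  obtain ⟨k, hk, e, h, hmin⟩ := firstReturn_spec f r x
  obtain ⟨k', hk', e', h', hmin'⟩ := firstReturn_spec f r x'
  have heq : (f ^ k) x = (f ^ k') x' := by rw [← e, ← e', hxx]
  rcases lt_trichotomy k k' with hlt | rfl | hlt
  · exact (key x x' k k' hlt hk h h' heq hmin').elim
  · exact (f ^ k).injective heq
  · exact (key x' x k' k hlt hk' h' h heq.symm hmin).elim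

/-- The first return map as a permutation. -/
noncomputable def firstReturnPerm {E : Type*} [Finite E] (f : Perm E) (r : Setoid E) : Perm E :=
  Equiv.ofBijective (firstReturn f r) (firstReturn_bijective f r)

/-! ### Embedded maps -/

/-- Embedded maps with edge set `E` and `n` external faces, of any genus and possibly
disconnected, encoded by permutations.

Every edge lies between a blue face (on its left) and a yellow face (on its right) when it is given
its prior orientation: counter-clockwise around blue faces, clockwise around yellow faces.
`blue x` is the edge that follows `x` around its blue face and `yellow x` the one that follows `x`
around its yellow face, so the faces are the cycles of `blue` and of `yellow`, and both `blue x`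
and `yellow x` start at the end point of `x`. Two edges start at the same vertex iff they are in
the same cycle of `blue * yellow⁻¹`, so the vertices are the cycles of that permutation.

`label x` is the oriented lattice edge from the image of the start to the image of the end of `x`
under the lattice embedding. The `i`-th external face is the yellow face of the edge `root i`,
the edge at which the boundary word is read from. -/
structure EmbeddedMap (d n : ℕ) (E : Type*) [Fintype E] [DecidableEq E] where
  blue : Perm E
  yellow : Perm E
  label : E → LatticeEdge d
  root : Fin n → E
  /-- the labels come from a graph homomorphism (blue side) and each blue face is sent to a single
  unoriented lattice edge -/
  label_blue : ∀ x, label (blue x) = (label x).symm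
  /-- the labels come from a graph homomorphism (yellow side) -/
  label_yellow : ∀ x, (label (yellow x)).fst = (label x).snd
  /-- distinct indices give distinct external faces -/
  root_face : ∀ i j, yellow.SameCycle (root i) (root j) → i = j
  /-- each internal yellow face is sent isomorphically to a plaquette -/
  plaquette : ∀ x, (∀ i, ¬ yellow.SameCycle (root i) x) →
    ∃ p : Plaquette d, (((yellow.toList x).map label : List _) : Cycle (LatticeEdge d)) = p.1

/-- The weights `w_i = (-1)^(i-1) Cat(i-1)`, for `i ≥ 1`. -/
def signedCatalan (i : ℕ) : ℤ := (-1) ^ (i - 1) * catalan (i - 1)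

namespace EmbeddedMap

variable {d n : ℕ} {E : Type*} [Fintype E] [DecidableEq E]

/-- Blue faces. -/
abbrev BlueFace (M : EmbeddedMap d n E) := Orbits M.blue

/-- Yellow faces, external ones included. -/
abbrev YellowFace (M : EmbeddedMap d n E) := Orbits M.yellow

/-- Vertices. -/
abbrev Vertex (M : EmbeddedMap d n E) := Orbits (M.blue * M.yellow⁻¹)

/-- The labels read around the yellow face of `x`, starting with `x`. -/
def yellowWord (M : EmbeddedMap d n E) (x : E) : List (LatticeEdge d) :=
  (M.yellow.toList x).map M.label

/-- The yellow face `F` is internal and is sent to the oriented plaquette `p`. -/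
def IsSentTo (M : EmbeddedMap d n E) (F : M.YellowFace) (p : Plaquette d) : Prop :=
  (∀ i, Orbits.mk M.yellow (M.root i) ≠ F) ∧
    ∃ x, Orbits.mk M.yellow x = F ∧ (M.yellowWord x : Cycle (LatticeEdge d)) = p.1

/-- `M` has boundary `s` and plaquette assignment `K`. -/
structure HasBoundary (M : EmbeddedMap d n E) (s : Fin n → LatticeLoop d)
    (K : Plaquette d → ℕ) : Prop where
  boundary : ∀ i, M.yellowWord (M.root i) = (s i).2.darts
  count : ∀ p, Nat.card {F : M.YellowFace // M.IsSentTo F p} = K p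

/-- `M` is a collection of `n` disks: each connected component has exactly one external face, and
every component has genus zero (`V - E + F = 2 n`, external faces being counted in `F`). -/
structure IsPlanar (M : EmbeddedMap d n E) : Prop where
  component : ∀ x, ∃! i, ∃ g ∈ Subgroup.closure {M.blue, M.yellow}, g (M.root i) = x
  euler : Fintype.card M.Vertex + (Fintype.card M.BlueFace + Fintype.card M.YellowFace) =
    Fintype.card E + 2 * n

/-- The dual graph: its vertices are all the faces, two of them adjacent when they share an edge. -/
def dualGraph (M : EmbeddedMap d n E) : SimpleGraph (M.BlueFace ⊕ M.YellowFace) :=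
  SimpleGraph.fromRel fun F G =>
    ∃ x, F = Sum.inl (Orbits.mk M.blue x) ∧ G = Sum.inr (Orbits.mk M.yellow x)

/-- The faces that remain when the blue faces sent to the unoriented lattice edge `e` are
removed. -/
def remainingFaces (M : EmbeddedMap d n E) (e : Sym2 (Fin d → ℤ)) :
    Set (M.BlueFace ⊕ M.YellowFace) :=
  {F | ∀ x, F = Sum.inl (Orbits.mk M.blue x) → (M.label x).edge ≠ e}

/-- Removing all the blue faces sent to a lattice edge never disconnects (any component of) the
dual graph. -/
def NonSeparable (M : EmbeddedMap d n E) : Prop :=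
  ∀ e ∈ (latticeGraph d).edgeSet, ∀ F G : M.remainingFaces e,
    M.dualGraph.Reachable F G → (M.dualGraph.induce (M.remainingFaces e)).Reachable F G

/-- Non-separable planar embedded maps with boundary `s` and plaquette assignment `K`. For `n = 1`
these are disks bounded by a single loop, for general `n` collections of such disks. -/
structure IsNPM (M : EmbeddedMap d n E) (s : Fin n → LatticeLoop d) (K : Plaquette d → ℕ) :
    Prop where
  hasBoundary : M.HasBoundary s K
  planar : M.IsPlanar
  nonSeparable : M.NonSeparable

/-- The weight `w_∞(M)`; `F.size` is the degree of the face `F`. -/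
noncomputable def weight (M : EmbeddedMap d n E) : ℤ :=
  ∏ F : M.BlueFace, signedCatalan (F.size / 2)

/-! ### Maps up to homeomorphism -/

/-- Isomorphism of embedded maps: a relabelling of the edges that respects the faces with their
orientations (i.e. an orientation-preserving homeomorphism), the lattice embedding, and the
position of the loops along the boundary. -/
def Iso (M M' : EmbeddedMap d n E) : Prop :=
  ∃ σ : Perm E, (∀ x, σ (M.blue x) = M'.blue (σ x)) ∧ (∀ x, σ (M.yellow x) = M'.yellow (σ x)) ∧
    (∀ x, M'.label (σ x) = M.label x) ∧ ∀ i, σ (M.root i) = M'.root i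

theorem iso_equivalence : Equivalence (Iso (d := d) (n := n) (E := E)) where
  refl M := ⟨1, by simp⟩
  symm := by
    rintro M M' ⟨σ, h1, h2, h3, h4⟩
    refine ⟨σ⁻¹, fun x => ?_, fun x => ?_, fun x => ?_, fun i => ?_⟩
    · rw [Perm.inv_eq_iff_eq, h1]; simp
    · rw [Perm.inv_eq_iff_eq, h2]; simp
    · rw [← h3]; simp
    · rw [Perm.inv_eq_iff_eq, h4]
  trans := by
    rintro M M' M'' ⟨σ, h1, h2, h3, h4⟩ ⟨τ, k1, k2, k3, k4⟩
    exact ⟨τ * σ, fun x => by simp [h1, k1], fun x => by simp [h2, k2],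
      fun x => by simp [h3, k3], fun i => by simp [h4, k4]⟩

instance isoSetoid (d n : ℕ) (E : Type*) [Fintype E] [DecidableEq E] :
    Setoid (EmbeddedMap d n E) := ⟨Iso, iso_equivalence⟩

theorem weight_eq_of_iso {M M' : EmbeddedMap d n E} (h : Iso M M') : M.weight = M'.weight := by
  obtain ⟨σ, h1, -⟩ := h
  have hconj : M'.blue = σ * M.blue * σ⁻¹ := by
    ext x; simp [h1]
  have hc : ∀ x x', M'.blue.SameCycle (σ x) (σ x') ↔ M.blue.SameCycle x x' := fun x x' => by
    rw [hconj, Perm.sameCycle_conj]; simp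
  let φ : M.BlueFace ≃ M'.BlueFace := Quotient.congr σ fun x x' => (hc x x').symm
  have hφ : ∀ x, φ (Orbits.mk M.blue x) = Orbits.mk M'.blue (σ x) := fun x => rfl
  refine Fintype.prod_equiv φ _ _ fun F => ?_
  have : F.size = (φ F).size := by
    refine Nat.card_congr (σ.subtypeEquiv fun x => ?_)
    rw [← hφ, φ.apply_eq_iff_eq]
  rw [this]

end EmbeddedMap

/-- Embedded maps considered up to homeomorphism. -/
def MapClass (d n : ℕ) (E : Type*) [Fintype E] [DecidableEq E] :=
  Quotient (EmbeddedMap.isoSetoid d n E)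

/-- The weight `w_∞` of a map considered up to homeomorphism. -/
noncomputable def MapClass.weight {d n : ℕ} {E : Type*} [Fintype E] [DecidableEq E]
    (m : MapClass d n E) : ℤ :=
  Quotient.lift EmbeddedMap.weight (fun _ _ h => EmbeddedMap.weight_eq_of_iso h) m

namespace EmbeddedMap

variable {d n : ℕ} {E : Type*} [Fintype E] [DecidableEq E]

/-! ### Pinchings

The vertices of a blue face `B` with disjoint vertices are identified with the edges of `B`, an
edge standing for the vertex at which it starts. Since the edges of `B` are alternately
sent to `e` and `e⁻¹`, two vertices of `B` are in the same partite class iff the labels of the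
corresponding edges agree. -/

/-- `u` and `v` are distinct vertices of `B` in the same partite class, so that the pinching
`pn_{u,v}` is defined. -/
def IsPinching (M : EmbeddedMap d n E) (B : M.BlueFace) (u v : E) : Prop :=
  Orbits.mk M.blue u = B ∧ Orbits.mk M.blue v = B ∧ u ≠ v ∧ M.label u = M.label v

/-- After pinching `u` and `v`, the vertices `u'` and `v'` are in two different blue faces. (The
pinching makes the predecessor of `u` be followed by `v`, and that of `v` by `u`.) -/
def Precludes (M : EmbeddedMap d n E) (u v u' v' : E) : Prop :=
  ¬ (swap u v * M.blue).SameCycle u' v'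

/-- Feasible collections of pinchings of `B`: collections without two pinchings in opposite partite
classes one of which precludes the other. -/
structure FeasibleCollection (M : EmbeddedMap d n E) (B : M.BlueFace) where
  pairs : Set (Sym2 E)
  isPinching : ∀ u v, s(u, v) ∈ pairs → M.IsPinching B u v
  feasible : ∀ u v u' v', s(u, v) ∈ pairs → s(u', v') ∈ pairs → M.label u ≠ M.label u' →
    ¬ M.Precludes u v u' v'

instance (M : EmbeddedMap d n E) (B : M.BlueFace) : Finite (M.FeasibleCollection B) :=
  Finite.of_injective FeasibleCollection.pairs fun P Q h => by
    cases P; cases Q; cases h; rfl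

/-- The vertices of `B` that get identified by a collection of pinchings: `u` and `v` for every
pinching `pn_{u,v}` of the collection, and all four vertices `u, v, u', v'` if `pn_{u,v}` precludes
`pn_{u',v'}` (the two being then in the same partite class). -/
def identification (M : EmbeddedMap d n E) (pairs : Set (Sym2 E)) : Setoid E :=
  Relation.EqvGen.setoid fun u u' => s(u, u') ∈ pairs ∨
    ∃ v v', s(u, v) ∈ pairs ∧ s(u', v') ∈ pairs ∧ M.Precludes u v u' v'

theorem FeasibleCollection.label_eq {M : EmbeddedMap d n E} {B : M.BlueFace}
    (P : M.FeasibleCollection B) {x x' : E} (h : M.identification P.pairs x x') :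
    M.label x = M.label x' := by
  induction (show Relation.EqvGen _ x x' from h) with
  | rel a a' hr =>
    rcases hr with h1 | ⟨v, v', h1, h2, hp⟩
    · exact (P.isPinching _ _ h1).2.2.2
    · by_contra hne
      exact P.feasible _ _ _ _ h1 h2 hne hp
  | refl => rfl
  | symm _ _ _ ih => exact (ih (by assumption)).symm
  | trans _ _ _ _ _ ih ih' => exact (ih (by assumption)).trans (ih' (by assumption))

/-- The map `Pn(M)` obtained by performing a feasible collection of pinchings of `B`: the vertices
of `B` are identified inside `B` as prescribed by the collection. An edge of `B` that ends at the
vertex `v` of `B` is now followed, around its new blue face, by the edge that starts at the last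
vertex before `v`, in the cyclic order around `B`, that is identified with `v` (at `v` itself, if
`v` is not pinched). The edges, the yellow faces and the lattice embedding are those of
`M`. -/
noncomputable def perform (M : EmbeddedMap d n E) {B : M.BlueFace} (P : M.FeasibleCollection B) :
    EmbeddedMap d n E where
  blue := firstReturnPerm M.blue⁻¹ (M.identification P.pairs) * M.blue
  yellow := M.yellow
  label := M.label
  root := M.root
  label_blue x := by
    obtain ⟨k, -, h, hr, -⟩ := firstReturn_spec M.blue⁻¹ (M.identification P.pairs) (M.blue x)
    rw [← h] at hr
    rw [← M.label_blue x]
    exact P.label_eq hr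
  label_yellow := M.label_yellow
  root_face := M.root_face
  plaquette := M.plaquette

/-- The valid feasible collections of pinchings of `B`: those that lead to a non-separable map. -/
def validPinchings (M : EmbeddedMap d n E) (B : M.BlueFace) : Set (M.FeasibleCollection B) :=
  {P | (M.perform P).NonSeparable}

/-- The invalid feasible collections of pinchings of `B`: those that lead to a separable map. -/
def invalidPinchings (M : EmbeddedMap d n E) (B : M.BlueFace) : Set (M.FeasibleCollection B) :=
  {P | ¬ (M.perform P).NonSeparable}

/-- The set of all the non-separable maps, up to homeomorphism, obtained from `M` by feasible
collections of pinchings of `B`. -/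
def validMaps (M : EmbeddedMap d n E) (B : M.BlueFace) : Set (MapClass d n E) :=
  (fun P : M.FeasibleCollection B => (Quotient.mk _ (M.perform P) : MapClass d n E)) ''
    M.validPinchings B

theorem validMaps_finite (M : EmbeddedMap d n E) (B : M.BlueFace) : (M.validMaps B).Finite :=
  (Set.toFinite _).image _

end EmbeddedMap

end SurfaceSum

/-! A map is handled through its blue permutation. Performing pinchings of `B` replaces `M.blue` by
a permutation `β` that differs from it only on `B`, respects the labels, and forms a genus-zero pair
with `M.blue` (`IsPinched`). The cycles of `β * M.blue⁻¹` are then the groups of identified corners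
of `B`, and genus zero says that these groups do not cross. Feasible collections produce exactly
these `β` (`isPinched_perform`, `IsPinched.exists_perform`). Different `β` give non-isomorphic maps,
because an isomorphism fixes the roots and everything stays connected to a root without `B`
(`blue_eq_of_iso`). So the sum runs over the valid permutations `β` (`sum_validMaps`).

The cancellation is local. Call a corner `a` of `B` free if the two edges of `B` at `a` stay
connected outside `B` whichever faces over another lattice edge are removed. Pinching at a free
corner does not change validity (`IsPinched.isValid_swap_mul_iff`). Group the valid `β` by the
result of detaching `a` from the corners identified with it. The members of a group are the ways of
splitting one face of degree `2m` at `a`, or leaving it whole, and for `m ≥ 2` their weights add up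
to zero by the Catalan recursion (`sum_permWeight_swap_mul`). Only those `β` survive in which `a` is
the corner of a digon made of `a` and the edge before it. This can be imposed at all free corners of
one partite class (`sum_eq_sum_isDigon`).

A corner that is not free forms an outer pair with another corner: contracting the blue faces over
some lattice edge other than that of `B` brings both to one vertex. Identifying an outer pair makes
the map separable (`IsOuterPair.not_isValid`). Hence:

If there is no outer pair, every corner is free and every collection is valid. Imposing digons on a
whole partite class leaves a single `β`, whose digons have weight `w_1 = 1`.

If there is an outer pair, some collection is invalid. Take a pair `u, v` as close as possible
around `B`. Outer pairs of opposite classes do not cross (`IsOuterPair.not_cross`, by planarity and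
the absence of triangles in the lattice), so by minimality the opposite-class corners between `u`
and `v` are free. Digons at all of them identify `u` with `v`, so no valid `β` survives and the sum
is zero.

Planarity enters through the Euler inequality `genus_nonneg` and its consequence
`PlanarPair.not_conn`: splitting a face at two corners of one vertex of a planar map separates these
corners. -/

namespace SurfaceSum

/-! ### Counting the classes of an equivalence relation -/

section Setoids

variable {E : Type*}

/-- The equivalence relation obtained from `s` by identifying `u` and `v`. -/
def glue (s : Setoid E) (u v : E) : Setoid E where
  r x y := s x y ∨ (s x u ∨ s x v) ∧ (s y u ∨ s y v)
  iseqv := by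
    refine ⟨fun x => Or.inl (s.refl x), ?_, ?_⟩
    · rintro x y (h | ⟨h, h'⟩)
      · exact Or.inl (s.symm h)
      · exact Or.inr ⟨h', h⟩
    · rintro x y z (h | ⟨h, h'⟩) (k | ⟨k, k'⟩)
      · exact Or.inl (s.trans h k)
      · exact Or.inr ⟨k.imp (s.trans h) (s.trans h), k'⟩
      · exact Or.inr ⟨h, h'.imp (s.trans (s.symm k)) (s.trans (s.symm k))⟩
      · exact Or.inr ⟨h, k'⟩

/-- This universal property makes `glue` commute with suprema and lets the effect of a transposition
on cycles be carried over to connected components. -/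
theorem glue_le_iff {s t : Setoid E} {u v : E} : glue s u v ≤ t ↔ s ≤ t ∧ t u v := by
  constructor
  · intro h
    exact ⟨fun x y hxy => h (Or.inl hxy),
      h (Or.inr ⟨Or.inl (s.refl u), Or.inr (s.refl v)⟩)⟩
  · rintro ⟨h, huv⟩ x y (hxy | ⟨hx, hy⟩)
    · exact h hxy
    · have hx' : t x u := hx.elim (fun k => h k) fun k => t.trans (h k) (t.symm huv)
      have hy' : t y u := hy.elim (fun k => h k) fun k => t.trans (h k) (t.symm huv)
      exact t.trans hx' (t.symm hy')

theorem le_glue (s : Setoid E) (u v : E) : s ≤ glue s u v := (glue_le_iff.1 le_rfl).1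

theorem glue_rel (s : Setoid E) (u v : E) : glue s u v u v := (glue_le_iff.1 le_rfl).2

theorem glue_eq_self {s : Setoid E} {u v : E} (h : s u v) : glue s u v = s :=
  le_antisymm (glue_le_iff.2 ⟨le_rfl, h⟩) (le_glue s u v)

theorem glue_sup (s t : Setoid E) (u v : E) : glue s u v ⊔ t = glue (s ⊔ t) u v := by
  apply le_antisymm
  · refine sup_le (glue_le_iff.2 ⟨le_sup_left.trans (le_glue _ _ _), glue_rel _ _ _⟩)
      (le_sup_right.trans (le_glue _ _ _))
  · refine glue_le_iff.2 ⟨sup_le_sup_right (le_glue _ _ _) _, ?_⟩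
    exact (le_sup_left : glue s u v ≤ glue s u v ⊔ t) (glue_rel _ _ _)

/-- The number of classes. -/
noncomputable def classCount (s : Setoid E) : ℕ := Nat.card (Quotient s)

theorem classCount_glue [Finite E] {s : Setoid E} {u v : E} (h : ¬ s u v) :
    classCount (glue s u v) + 1 = classCount s := by
  classical
  -- Dropping the class of `v` leaves one representative for each glued class.
  let φ : {q : Quotient s // q ≠ Quotient.mk s v} → Quotient (glue s u v) := fun q =>
    Quotient.map' (s₁ := s) (s₂ := glue s u v) id (fun x y hxy => Or.inl hxy) q.1
  have hφ : Function.Bijective φ := by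
    constructor
    · rintro ⟨q, hq⟩ ⟨q', hq'⟩ heq
      induction q using Quotient.inductionOn with | _ x
      induction q' using Quotient.inductionOn with | _ y
      have hx : ¬ s x v := fun k => hq (Quotient.sound k)
      have hy : ¬ s y v := fun k => hq' (Quotient.sound k)
      have hxy : glue s u v x y := Quotient.exact heq
      refine Subtype.ext (Quotient.sound ?_)
      rcases hxy with k | ⟨k, k'⟩
      · exact k
      · exact s.trans (k.resolve_right hx) (s.symm (k'.resolve_right hy))
    · intro q
      induction q using Quotient.inductionOn with | _ z
      by_cases hz : s z v
      · exact ⟨⟨Quotient.mk s u, fun k => h (Quotient.exact k)⟩,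
          Quotient.sound (s := glue s u v)
            (Or.inr ⟨Or.inl (s.refl u), Or.inr hz⟩)⟩
      · exact ⟨⟨Quotient.mk s z, fun k => hz (Quotient.exact k)⟩, rfl⟩
  have : Fintype (Quotient s) := Fintype.ofFinite _
  rw [classCount, classCount, ← Nat.card_congr (Equiv.ofBijective φ hφ),
    Nat.card_eq_fintype_card, Nat.card_eq_fintype_card, Fintype.card_subtype,
    Finset.filter_ne', Finset.card_erase_of_mem (Finset.mem_univ _), Finset.card_univ]
  exact Nat.sub_add_cancel (Fintype.card_pos_iff.2 ⟨Quotient.mk s v⟩)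

theorem classCount_le_glue [Finite E] (s : Setoid E) (u v : E) :
    classCount s ≤ classCount (glue s u v) + 1 := by
  by_cases h : s u v
  · rw [glue_eq_self h]; omega
  · rw [classCount_glue h]

end Setoids

/-! ### Cycles of permutations and transpositions -/

section Cycles

variable {E : Type*}

/-- The equivalence relation of being in the same cycle. -/
abbrev cycles (f : Perm E) : Setoid E := Perm.SameCycle.setoid f

theorem sameCycle_apply_self (f : Perm E) (x : E) : f.SameCycle x (f x) := ⟨1, by simp⟩

/-- Comparisons of connectivity relations are reduced by this to a check on single steps of a
permutation. -/
theorem cycles_le_iff {f : Perm E} {t : Setoid E} : cycles f ≤ t ↔ ∀ x, t x (f x) := by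
  constructor
  · exact fun h x => h (sameCycle_apply_self f x)
  · rintro h x y ⟨i, rfl⟩
    induction i with
    | zero => exact t.refl x
    | succ i ih =>
      rw [add_comm, zpow_add, zpow_one, Perm.mul_apply]
      exact t.trans ih (h _)
    | pred i ih =>
      refine t.trans ih ?_
      rw [sub_eq_add_neg, add_comm, zpow_add, zpow_neg_one, Perm.mul_apply]
      have := h (f⁻¹ ((f ^ (-(i : ℤ))) x))
      exact t.symm (by simpa using this)

/-- Permutations that agree on an invariant set have the same cycles there. -/
theorem sameCycle_congr_on {f g : Perm E} {S : Set E} (hS : ∀ x ∈ S, f x = g x ∧ f x ∈ S)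
    [Finite E] {x y : E} (hx : x ∈ S) (h : f.SameCycle x y) : g.SameCycle x y ∧ y ∈ S := by
  obtain ⟨i, -, rfl⟩ := h.exists_pow_eq'
  clear h
  induction i with
  | zero => exact ⟨Perm.SameCycle.refl _ _, hx⟩
  | succ i ih =>
    rw [pow_succ', Perm.mul_apply]
    refine ⟨?_, (hS _ ih.2).2⟩
    rw [(hS _ ih.2).1]
    exact ih.1.trans (sameCycle_apply_self _ _)

theorem period_pos [Finite E] (f : Perm E) (x : E) : 0 < Function.minimalPeriod f x :=
  Function.minimalPeriod_pos_of_mem_periodicPts (f.injective.mem_periodicPts x)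

theorem pow_period (f : Perm E) (x : E) : (f ^ Function.minimalPeriod f x) x = x := by
  rw [← Perm.iterate_eq_pow]; exact Function.iterate_minimalPeriod

theorem pow_inj_of_lt_period {f : Perm E} {x : E} {i j : ℕ} (hi : i < Function.minimalPeriod f x)
    (hj : j < Function.minimalPeriod f x) (h : (f ^ i) x = (f ^ j) x) : i = j := by
  rw [← Perm.iterate_eq_pow, ← Perm.iterate_eq_pow] at h
  exact Function.iterate_injOn_Iio_minimalPeriod hi hj h

theorem sameCycle_iff_exists_lt_period [Finite E] {f : Perm E} {x y : E} :
    f.SameCycle x y ↔ ∃ i < Function.minimalPeriod f x, (f ^ i) x = y := by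
  constructor
  · intro h
    obtain ⟨i, -, rfl⟩ := h.exists_pow_eq'
    refine ⟨i % Function.minimalPeriod f x, Nat.mod_lt _ (period_pos f x), ?_⟩
    rw [← Perm.iterate_eq_pow, ← Perm.iterate_eq_pow, Function.iterate_mod_minimalPeriod_eq]
  · rintro ⟨i, -, rfl⟩
    exact ⟨i, by simp⟩

variable [DecidableEq E]

/-- Multiplying by the transposition on the left redirects the arrow entering `(f ^ j) x` to `x`, so
the orbit of `x` is unchanged until it closes up after `j` steps. -/
theorem swap_mul_pow {f : Perm E} {x : E} {j : ℕ} (hj : j < Function.minimalPeriod f x) {i : ℕ}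
    (hi : i < j) : ((swap x ((f ^ j) x) * f) ^ i) x = (f ^ i) x := by
  induction i with
  | zero => rfl
  | succ i ih =>
    rw [pow_succ', Perm.mul_apply, ih (by omega), Perm.mul_apply, ← Perm.mul_apply f,
      ← pow_succ']
    apply swap_apply_of_ne_of_ne
    · intro h
      have := pow_inj_of_lt_period (j := 0) (by omega) (by omega) h
      omega
    · intro h
      have := pow_inj_of_lt_period (by omega) hj h
      omega

theorem swap_mul_pow_self {f : Perm E} {x : E} {j : ℕ} (hj : j < Function.minimalPeriod f x)
    (h0 : 0 < j) : ((swap x ((f ^ j) x) * f) ^ j) x = x := by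
  obtain ⟨i, rfl⟩ : ∃ i, j = i + 1 := ⟨j - 1, by omega⟩
  rw [pow_succ', Perm.mul_apply, swap_mul_pow hj (by omega), Perm.mul_apply, ← Perm.mul_apply f,
    ← pow_succ', swap_apply_right]

/-- The cycle of `x` after a transposition of two points of a cycle. -/
theorem sameCycle_swap_mul_pow_iff [Finite E] {f : Perm E} {x y : E} {j : ℕ}
    (hj : j < Function.minimalPeriod f x) (h0 : 0 < j) :
    (swap x ((f ^ j) x) * f).SameCycle x y ↔ ∃ i < j, (f ^ i) x = y := by
  constructor
  · intro h
    obtain ⟨i, -, rfl⟩ := h.exists_pow_eq'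
    refine ⟨i % j, Nat.mod_lt _ h0, ?_⟩
    rw [← swap_mul_pow hj (Nat.mod_lt i h0)]
    conv_rhs => rw [← Nat.mod_add_div i j, pow_add, Perm.mul_apply, pow_mul]
    congr 1
    symm
    have : Function.IsFixedPt ((swap x ((f ^ j) x) * f) ^ j) x := swap_mul_pow_self hj h0
    rw [← Perm.iterate_eq_pow ((swap x ((f ^ j) x) * f) ^ j)]
    exact this.iterate _
  · rintro ⟨i, hi, rfl⟩
    rw [← swap_mul_pow hj hi]
    exact ⟨i, by simp⟩

theorem not_sameCycle_swap_mul [Finite E] {f : Perm E} {u v : E} (huv : u ≠ v)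
    (h : f.SameCycle u v) : ¬ (swap u v * f).SameCycle u v := by
  obtain ⟨j, hj, rfl⟩ := sameCycle_iff_exists_lt_period.1 h
  have h0 : 0 < j := Nat.pos_of_ne_zero fun h0 => huv (by simp [h0])
  rw [sameCycle_swap_mul_pow_iff hj h0]
  rintro ⟨i, hi, h⟩
  have := pow_inj_of_lt_period (by omega) hj h
  omega

/-- The orbit of `u` is followed for a full period of `f`; the step that would return to `u` now
goes to `v`. -/
theorem sameCycle_swap_mul [Finite E] {f : Perm E} {u v : E} (h : ¬ f.SameCycle u v) :
    (swap u v * f).SameCycle u v := by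
  have key : ∀ i < Function.minimalPeriod f u, ((swap u v * f) ^ i) u = (f ^ i) u := by
    intro i hi
    induction i with
    | zero => rfl
    | succ i ih =>
      rw [pow_succ', Perm.mul_apply, ih (by omega), Perm.mul_apply, ← Perm.mul_apply f,
        ← pow_succ']
      apply swap_apply_of_ne_of_ne
      · intro k
        have := pow_inj_of_lt_period (j := 0) hi (by omega) k
        omega
      · intro k
        exact h ⟨(i + 1 : ℕ), by rw [zpow_natCast]; exact k⟩
  obtain ⟨N, hN⟩ : ∃ N, Function.minimalPeriod f u = N + 1 :=
    ⟨_, (Nat.succ_pred_eq_of_pos (period_pos f u)).symm⟩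
  refine ⟨(N + 1 : ℕ), ?_⟩
  rw [zpow_natCast, pow_succ', Perm.mul_apply, key N (by omega), Perm.mul_apply,
    ← Perm.mul_apply f, ← pow_succ', ← hN, pow_period, swap_apply_left]

theorem cycles_swap_mul [Finite E] {f : Perm E} {u v : E} (h : ¬ f.SameCycle u v) :
    cycles (swap u v * f) = glue (cycles f) u v := by
  apply le_antisymm
  · rw [cycles_le_iff]
    intro x
    have hx : glue (cycles f) u v x (f x) := le_glue _ _ _ (sameCycle_apply_self f x)
    refine Setoid.trans' _ hx ?_
    rw [Perm.mul_apply]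
    rcases eq_or_ne (f x) u with k | k
    · rw [k, swap_apply_left]; exact glue_rel _ _ _
    rcases eq_or_ne (f x) v with k' | k'
    · rw [k', swap_apply_right]; exact (glue _ _ _).symm (glue_rel _ _ _)
    · rw [swap_apply_of_ne_of_ne k k']
  · have huv := sameCycle_swap_mul h
    refine glue_le_iff.2 ⟨cycles_le_iff.2 fun x => ?_, huv⟩
    have hx := sameCycle_apply_self (swap u v * f) x
    rw [Perm.mul_apply] at hx
    rcases eq_or_ne (f x) u with k | k
    · rw [k, swap_apply_left] at hx; rw [k]; exact hx.trans huv.symm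
    rcases eq_or_ne (f x) v with k' | k'
    · rw [k', swap_apply_right] at hx; rw [k']; exact hx.trans huv
    · rwa [swap_apply_of_ne_of_ne k k'] at hx

theorem cycles_eq_glue [Finite E] {f : Perm E} {u v : E} (h : f.SameCycle u v) :
    cycles f = glue (cycles (swap u v * f)) u v := by
  rcases eq_or_ne u v with rfl | huv
  · rw [swap_self, ← Perm.one_def, one_mul, glue_eq_self (Setoid.refl' _ _)]
  · have := cycles_swap_mul (not_sameCycle_swap_mul huv h)
    rwa [swap_mul_self_mul] at this

theorem classCount_swap_mul [Finite E] {f : Perm E} {u v : E} (h : ¬ f.SameCycle u v) :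
    classCount (cycles (swap u v * f)) + 1 = classCount (cycles f) := by
  rw [cycles_swap_mul h, classCount_glue h]

theorem classCount_swap_mul' [Finite E] {f : Perm E} {u v : E} (huv : u ≠ v)
    (h : f.SameCycle u v) : classCount (cycles (swap u v * f)) = classCount (cycles f) + 1 := by
  rw [cycles_eq_glue h, classCount_glue (not_sameCycle_swap_mul huv h)]

/-- After a transposition of `u` and `v`, each point of their cycle is connected to one of them. -/
theorem sameCycle_swap_mul_or [Finite E] {f : Perm E} {u v x : E} (h : f.SameCycle u v)
    (hx : f.SameCycle u x) :
    (swap u v * f).SameCycle x u ∨ (swap u v * f).SameCycle x v := by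
  have : glue (cycles (swap u v * f)) u v x u := by
    rw [← cycles_eq_glue h]; exact hx.symm
  rcases this with k | ⟨k, -⟩
  · exact Or.inl k
  · exact k

/-- Two points of the cycle of `o` remain in the same cycle after a transposition iff they are on
the same side. -/
theorem sameCycle_swap_mul_pow_pow_iff [Finite E] {f : Perm E} {o : E} {i j k l : ℕ}
    (hij : i < j) (hj : j < Function.minimalPeriod f o) (hk : k < Function.minimalPeriod f o)
    (hl : l < Function.minimalPeriod f o) :
    (swap ((f ^ i) o) ((f ^ j) o) * f).SameCycle ((f ^ k) o) ((f ^ l) o) ↔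
      ((i ≤ k ∧ k < j) ↔ (i ≤ l ∧ l < j)) := by
  have hper : Function.minimalPeriod f ((f ^ i) o) = Function.minimalPeriod f o := by
    rw [← Perm.iterate_eq_pow]
    exact Function.minimalPeriod_apply_iterate (f.injective.mem_periodicPts o) i
  have hjo : (f ^ (j - i)) ((f ^ i) o) = (f ^ j) o := by
    rw [← Perm.mul_apply, ← pow_add]; congr 2; omega
  -- The transposition cuts the cycle of `o` into the arc of positions `[i, j)` and its complement,
  -- which contains position `j`.
  have hu : ∀ m < Function.minimalPeriod f o,
      ((swap ((f ^ i) o) ((f ^ j) o) * f).SameCycle ((f ^ i) o) ((f ^ m) o) ↔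
        (i ≤ m ∧ m < j)) := by
    intro m hm
    rw [← hjo, sameCycle_swap_mul_pow_iff (by omega) (by omega)]
    constructor
    · rintro ⟨t, ht, h⟩
      rw [← Perm.mul_apply, ← pow_add] at h
      have := pow_inj_of_lt_period (by omega) hm h
      omega
    · intro h
      refine ⟨m - i, by omega, ?_⟩
      rw [← Perm.mul_apply, ← pow_add]; congr 2; omega
  have hsame : ∀ m n : ℕ, f.SameCycle ((f ^ m) o) ((f ^ n) o) := fun m n =>
    (show f.SameCycle o ((f ^ m) o) from ⟨m, by simp⟩).symm.trans ⟨n, by simp⟩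
  have hor : ∀ m, (swap ((f ^ i) o) ((f ^ j) o) * f).SameCycle ((f ^ m) o) ((f ^ i) o) ∨
      (swap ((f ^ i) o) ((f ^ j) o) * f).SameCycle ((f ^ m) o) ((f ^ j) o) := fun m =>
    sameCycle_swap_mul_or (hsame _ _) (hsame _ _)
  rw [← hu k hk, ← hu l hl]
  constructor
  · exact fun h => ⟨fun h' => h'.trans h, fun h' => h'.trans h.symm⟩
  · intro h
    rcases hor k with h1 | h1
    · exact h1.trans (h.1 h1.symm)
    rcases hor l with h2 | h2
    · exact (h.2 h2.symm).symm.trans h2.symm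
    · exact h1.trans h2.symm

/-- Two chords cross or not independently of the order in which they are considered. -/
theorem sameCycle_swap_mul_comm [Finite E] {f : Perm E} {u v x y : E} (huv : f.SameCycle u v)
    (hux : f.SameCycle u x) (hxy : f.SameCycle x y) (h1 : u ≠ x) (h2 : u ≠ y) (h3 : v ≠ x)
    (h4 : v ≠ y) (h : (swap u v * f).SameCycle x y) : (swap x y * f).SameCycle u v := by
  obtain ⟨j, hj, rfl⟩ := sameCycle_iff_exists_lt_period.1 huv
  obtain ⟨k, hk, rfl⟩ := sameCycle_iff_exists_lt_period.1 hux
  obtain ⟨l, hl, rfl⟩ := sameCycle_iff_exists_lt_period.1 (hux.trans hxy)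
  rcases Nat.eq_zero_or_pos j with rfl | hj0
  · exact Perm.SameCycle.refl _ _
  have e := sameCycle_swap_mul_pow_pow_iff (f := f) (o := u) (i := 0) hj0 hj hk hl
  rw [pow_zero, Perm.one_apply] at e
  rw [e] at h
  have hk0 : k ≠ 0 := fun h => h1 (by rw [h]; rfl)
  have hl0 : l ≠ 0 := fun h => h2 (by rw [h]; rfl)
  have hjk : k ≠ j := fun h => h3 (by rw [h])
  have hjl : l ≠ j := fun h => h4 (by rw [h])
  rcases lt_trichotomy k l with hkl | rfl | hkl
  · have e' := sameCycle_swap_mul_pow_pow_iff (f := f) (o := u) hkl hl (period_pos f u) hj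
    rw [pow_zero, Perm.one_apply] at e'
    rw [e']
    omega
  · rw [swap_self, ← Perm.one_def, one_mul]; exact huv
  · have e' := sameCycle_swap_mul_pow_pow_iff (f := f) (o := u) hkl hk (period_pos f u) hj
    rw [pow_zero, Perm.one_apply] at e'
    rw [swap_comm, e']
    omega

/-- Two chords on different sides of a third one do not cross. -/
theorem sameCycle_swap_mul_of_sides [Finite E] {f : Perm E} {u v x x' y y' : E}
    (huv : f.SameCycle u v) (hux : f.SameCycle u x) (hux' : f.SameCycle u x')
    (huy : f.SameCycle u y) (huy' : f.SameCycle u y')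
    (hx : (swap u v * f).SameCycle x x') (hy : (swap u v * f).SameCycle y y')
    (hxy : ¬ (swap u v * f).SameCycle x y) : (swap x x' * f).SameCycle y y' := by
  obtain ⟨j, hj, rfl⟩ := sameCycle_iff_exists_lt_period.1 huv
  obtain ⟨k, hk, rfl⟩ := sameCycle_iff_exists_lt_period.1 hux
  obtain ⟨k', hk', rfl⟩ := sameCycle_iff_exists_lt_period.1 hux'
  obtain ⟨l, hl, rfl⟩ := sameCycle_iff_exists_lt_period.1 huy
  obtain ⟨l', hl', rfl⟩ := sameCycle_iff_exists_lt_period.1 huy'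
  rcases Nat.eq_zero_or_pos j with rfl | hj0
  · rw [pow_zero, Perm.one_apply, swap_self, ← Perm.one_def, one_mul] at hxy
    exact (hxy (hux.symm.trans huy)).elim
  have e : ∀ {k l : ℕ}, k < Function.minimalPeriod f u → l < Function.minimalPeriod f u → _ :=
    fun {k l} hk hl => sameCycle_swap_mul_pow_pow_iff (f := f) (o := u) (i := 0) hj0 hj
      (k := k) (l := l) hk hl
  simp only [pow_zero, Perm.one_apply] at e
  rw [e hk hk'] at hx
  rw [e hl hl'] at hy
  rw [e hk hl] at hxy
  rcases lt_trichotomy k k' with hkl | rfl | hkl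
  · rw [sameCycle_swap_mul_pow_pow_iff (f := f) (o := u) hkl hk' hl hl']
    omega
  · rw [swap_self, ← Perm.one_def, one_mul]; exact huy.symm.trans huy'
  · rw [swap_comm, sameCycle_swap_mul_pow_pow_iff (f := f) (o := u) hkl hk hl hl']
    omega

end Cycles

end SurfaceSum

namespace SurfaceSum

/-! ### The genus of a pair of permutations -/

section Genus

variable {E : Type*}

/-- The connected components of the hypermap `(b, y)`. -/
abbrev conn (b y : Perm E) : Setoid E := cycles b ⊔ cycles y

theorem conn_le_iff {b y : Perm E} {t : Setoid E} :
    conn b y ≤ t ↔ (∀ x, t x (b x)) ∧ ∀ x, t x (y x) := by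
  rw [sup_le_iff, cycles_le_iff, cycles_le_iff]

theorem cycles_le_conn_left (b y : Perm E) : cycles b ≤ conn b y := le_sup_left

theorem cycles_le_conn_right (b y : Perm E) : cycles y ≤ conn b y := le_sup_right

theorem conn_left (b y : Perm E) (x : E) : conn b y x (b x) := (conn_le_iff.1 le_rfl).1 x

theorem conn_right (b y : Perm E) (x : E) : conn b y x (y x) := (conn_le_iff.1 le_rfl).2 x

theorem cycles_mul_inv_le_conn (b y : Perm E) : cycles (b * y⁻¹) ≤ conn b y := by
  rw [cycles_le_iff]
  intro x
  have h1 := conn_right b y (y⁻¹ x)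
  rw [show y (y⁻¹ x) = x from y.apply_symm_apply x] at h1
  exact Setoid.trans' _ (Setoid.symm' _ h1) (conn_left b y _)

/-- The number of cycles. -/
noncomputable abbrev cycleCount (f : Perm E) : ℕ := classCount (cycles f)

theorem cycleCount_inv (f : Perm E) : cycleCount f⁻¹ = cycleCount f := by
  have : cycles f⁻¹ = cycles f := by
    ext x y; exact Perm.sameCycle_inv
  rw [cycleCount, this]

theorem cycleCount_one : cycleCount (1 : Perm E) = Nat.card E := by
  refine Nat.card_congr (Equiv.ofBijective (fun x => Quotient.mk (cycles (1 : Perm E)) x)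
    ⟨fun x y h => ?_, Quotient.mk_surjective⟩).symm
  exact Perm.sameCycle_one.1 (Quotient.exact h)

/-- The hypermap `(b, y)` is planar: all its components have genus zero. -/
def PlanarPair (b y : Perm E) : Prop :=
  cycleCount (b * y⁻¹) + cycleCount b + cycleCount y = Nat.card E + 2 * classCount (conn b y)

theorem PlanarPair.symm {b y : Perm E} (h : PlanarPair b y) : PlanarPair y b := by
  have h1 : cycleCount (y * b⁻¹) = cycleCount (b * y⁻¹) := by
    rw [← cycleCount_inv, mul_inv_rev, inv_inv]
  unfold PlanarPair at *
  rw [h1, conn, sup_comm]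
  change _ = _ + 2 * classCount (conn b y)
  omega

variable [Finite E]

/-- The Euler characteristic of a hypermap is at most twice its number of components. -/
theorem genus_nonneg [DecidableEq E] (b y : Perm E) :
    cycleCount (b * y⁻¹) + cycleCount b + cycleCount y ≤
      Nat.card E + 2 * classCount (conn b y) := by
  have := Fintype.ofFinite E
  induction hs : y.support.card using Nat.strong_induction_on generalizing y with | _ N ih
  by_cases hy : y = 1
  · subst hy
    -- With `y = 1` every component is a cycle of `b`, and equality holds.
    have h1 : conn b 1 = cycles b :=
      sup_eq_left.2 (cycles_le_iff.2 fun x => Setoid.refl' _ x)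
    rw [h1, inv_one, mul_one, cycleCount_one, classCount]
    change Nat.card (Quotient (cycles b)) + Nat.card (Quotient (cycles b)) + _ ≤ _
    omega
  obtain ⟨x, hx⟩ : ∃ x, y x ≠ x := by
    by_contra! h
    exact hy (Equiv.ext h)
  have hxy : y.SameCycle x (y x) := sameCycle_apply_self y x
  have key := ih _ (hs ▸ Perm.card_support_swap_mul hx) (swap x (y x) * y) rfl
  have e1 : cycleCount (swap x (y x) * y) = cycleCount y + 1 :=
    classCount_swap_mul' (Ne.symm hx) hxy
  have e2 : conn b y = glue (conn b (swap x (y x) * y)) x (y x) := by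
    rw [conn, cycles_eq_glue hxy, sup_comm, glue_sup, sup_comm]
  -- Detaching `x` from its cycle of `y` acts on the vertices as a transposition too, so each count
  -- changes by at most one.
  have e3 : b * (swap x (y x) * y)⁻¹ = swap (b (y⁻¹ x)) (b x) * (b * y⁻¹) := by
    rw [mul_inv_rev, swap_inv, ← mul_assoc, mul_swap_eq_swap_mul]
    simp
  have e4 : classCount (conn b (swap x (y x) * y)) ≤ classCount (conn b y) + 1 := by
    rw [e2]; exact classCount_le_glue _ _ _
  by_cases hv : (b * y⁻¹).SameCycle (b (y⁻¹ x)) (b x)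
  · have hne : b (y⁻¹ x) ≠ b x := by
      intro h
      exact hx ((Perm.inv_eq_iff_eq.1 (b.injective h)).symm)
    have e5 : cycleCount (swap (b (y⁻¹ x)) (b x) * (b * y⁻¹)) = cycleCount (b * y⁻¹) + 1 :=
      classCount_swap_mul' hne hv
    rw [e3] at key
    omega
  · have e5 : cycleCount (swap (b (y⁻¹ x)) (b x) * (b * y⁻¹)) + 1 = cycleCount (b * y⁻¹) :=
      classCount_swap_mul hv
    -- When two vertices merge, the inequality closes only if no component splits. The merged vertex
    -- provides the connection between `x` and `y x`.
    have e6 : conn b (swap x (y x) * y) x (y x) := by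
      have h1 : conn b (swap x (y x) * y) (b (y⁻¹ x)) (b x) := by
        apply cycles_mul_inv_le_conn
        rw [e3]
        exact sameCycle_swap_mul hv
      have h2 : conn b (swap x (y x) * y) (y⁻¹ x) x :=
        Setoid.trans' _ (conn_left b _ _)
          (Setoid.trans' _ h1 (Setoid.symm' _ (conn_left b _ _)))
      have h3 := conn_right b (swap x (y x) * y) (y⁻¹ x)
      rw [Perm.mul_apply, show y (y⁻¹ x) = x from y.apply_symm_apply x, swap_apply_left] at h3
      exact Setoid.trans' _ (Setoid.symm' _ h2) h3
    rw [e3] at key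
    rw [e2, glue_eq_self e6]
    omega

variable [DecidableEq E]

/-- Splitting a cycle of `b` preserves planarity. -/
theorem PlanarPair.swap_mul {b y : Perm E} (h : PlanarPair b y) {u v : E}
    (huv : b.SameCycle u v) : PlanarPair (swap u v * b) y := by
  rcases eq_or_ne u v with rfl | hne
  · rwa [swap_self, ← Perm.one_def, one_mul]
  have e1 : cycleCount (swap u v * b) = cycleCount b + 1 := classCount_swap_mul' hne huv
  have e2 : conn b y = glue (conn (swap u v * b) y) u v := by
    rw [conn, cycles_eq_glue huv, glue_sup]
  have hg := genus_nonneg (swap u v * b) y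
  unfold PlanarPair at *
  -- If `u` and `v` are at one vertex, both faces and vertices increase by one, and `genus_nonneg`
  -- forces a new component. Otherwise the vertices merge, which offsets the new face and keeps the
  -- component whole.
  by_cases hv : (b * y⁻¹).SameCycle u v
  · have e3 : cycleCount (swap u v * (b * y⁻¹)) = cycleCount (b * y⁻¹) + 1 :=
      classCount_swap_mul' hne hv
    have e4 : classCount (conn (swap u v * b) y) ≤ classCount (conn b y) + 1 := by
      rw [e2]; exact classCount_le_glue _ _ _
    rw [mul_assoc] at hg ⊢
    omega
  · have e3 : cycleCount (swap u v * (b * y⁻¹)) + 1 = cycleCount (b * y⁻¹) :=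
      classCount_swap_mul hv
    have e4 : conn (swap u v * b) y u v := by
      apply cycles_mul_inv_le_conn
      rw [mul_assoc]
      exact sameCycle_swap_mul hv
    rw [e2, glue_eq_self e4] at h
    rw [mul_assoc]
    omega

/-- Pinching a face at two corners of the same vertex disconnects a planar map. -/
theorem PlanarPair.not_conn {b y : Perm E} (h : PlanarPair b y) {u v : E} (hne : u ≠ v)
    (huv : b.SameCycle u v) (hv : (b * y⁻¹).SameCycle u v) : ¬ conn (swap u v * b) y u v := by
  intro hc
  have e1 : cycleCount (swap u v * b) = cycleCount b + 1 := classCount_swap_mul' hne huv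
  have e2 : conn b y = glue (conn (swap u v * b) y) u v := by
    rw [conn, cycles_eq_glue huv, glue_sup]
  have e3 : cycleCount (swap u v * (b * y⁻¹)) = cycleCount (b * y⁻¹) + 1 :=
    classCount_swap_mul' hne hv
  -- One more face and one more vertex with no more components would exceed the Euler bound.
  have hg := genus_nonneg (swap u v * b) y
  rw [mul_assoc] at hg
  unfold PlanarPair at h
  rw [e2, glue_eq_self hc] at h
  omega

end Genus

/-! ### Removing faces -/

section Collapse

variable {E : Type*}

open Classical in
/-- The permutation `f` with the cycles in the set `T` replaced by fixed points (`f` itself if `T`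
is not a union of cycles). As an operation on maps, this contracts the blue faces in `T`. -/
noncomputable def collapse (f : Perm E) (T : Set E) : Perm E :=
  if h : ∀ x, f x ∈ T ↔ x ∈ T then
    { toFun := fun x => if x ∈ T then x else f x
      invFun := fun x => if x ∈ T then x else f⁻¹ x
      left_inv := fun x => by
        by_cases hx : x ∈ T
        · simp [hx]
        · have : f x ∉ T := fun k => hx ((h x).1 k)
          simp [hx, this]
      right_inv := fun x => by
        by_cases hx : x ∈ T
        · simp [hx]
        · have : f⁻¹ x ∉ T := fun k => hx (by simpa using (h (f⁻¹ x)).2 k)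
          dsimp only
          rw [if_neg hx, if_neg this]
          exact f.apply_symm_apply x }
  else f

variable {f : Perm E} {T : Set E}

theorem collapse_of_mem (h : ∀ x, f x ∈ T ↔ x ∈ T) {x : E} (hx : x ∈ T) :
    collapse f T x = x := by
  rw [collapse, dif_pos h]; exact if_pos hx

theorem collapse_of_notMem (h : ∀ x, f x ∈ T ↔ x ∈ T) {x : E} (hx : x ∉ T) :
    collapse f T x = f x := by
  rw [collapse, dif_pos h]; exact if_neg hx

/-- Turning cycles into fixed points is a succession of splittings, each detaching one point, and
each splitting preserves planarity. The permutation `g` is kept separate from `f` so that the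
induction can vary `f`. -/
theorem PlanarPair.of_fixed [Finite E] [DecidableEq E] {f g y : Perm E} {T : Set E}
    (hp : PlanarPair f y)
    (h : ∀ x, f x ∈ T ↔ x ∈ T) (h1 : ∀ x ∈ T, g x = x) (h2 : ∀ x ∉ T, g x = f x) :
    PlanarPair g y := by
  have := Fintype.ofFinite E
  induction hs : f.support.card using Nat.strong_induction_on generalizing f with | _ N ih
  by_cases hT : ∃ x ∈ T, f x ≠ x
  · obtain ⟨x, hx, hne⟩ := hT
    have hfx : f x ∈ T := (h x).2 hx
    refine ih _ (hs ▸ Perm.card_support_swap_mul hne) (hp.swap_mul (sameCycle_apply_self f x))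
      (fun z => ?_) (fun z hz => ?_) rfl
    · rw [← h z, Perm.mul_apply]
      rcases eq_or_ne (f z) x with k | k
      · rw [k, swap_apply_left]; exact iff_of_true hfx hx
      rcases eq_or_ne (f z) (f x) with k' | k'
      · rw [k', swap_apply_right]; exact iff_of_true hx hfx
      · rw [swap_apply_of_ne_of_ne k k']
    · rw [h2 z hz, Perm.mul_apply]
      have hz' : f z ∉ T := fun k => hz ((h z).1 k)
      rw [swap_apply_of_ne_of_ne] <;> rintro k <;> rw [k] at hz' <;> contradiction
  · push Not at hT
    have : g = f := by
      ext x
      by_cases hx : x ∈ T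
      · rw [h1 x hx, hT x hx]
      · rw [h2 x hx]
    rwa [this]

/-- Removing faces preserves planarity. -/
theorem PlanarPair.collapse [Finite E] [DecidableEq E] {f y : Perm E} {T : Set E}
    (hp : PlanarPair f y)
    (h : ∀ x, f x ∈ T ↔ x ∈ T) : PlanarPair (collapse f T) y :=
  hp.of_fixed h (fun _ hx => collapse_of_mem h hx) fun _ hx => collapse_of_notMem h hx

end Collapse

end SurfaceSum

namespace SurfaceSum

/-! ### First return maps -/

section FirstReturn

variable {E : Type*} [Finite E]

theorem firstReturn_rel (f : Perm E) (r : Setoid E) (x : E) : r (firstReturn f r x) x := by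
  obtain ⟨k, -, e, h, -⟩ := firstReturn_spec f r x
  rwa [e]

theorem firstReturn_eq {f : Perm E} {r : Setoid E} {x : E} {k : ℕ} (hk : 0 < k)
    (h : r ((f ^ k) x) x) (hmin : ∀ j, 0 < j → j < k → ¬ r ((f ^ j) x) x) :
    firstReturn f r x = (f ^ k) x := by
  obtain ⟨l, hl, e, h', hmin'⟩ := firstReturn_spec f r x
  rcases lt_trichotomy k l with hkl | rfl | hkl
  · exact (hmin' k hk hkl h).elim
  · exact e
  · exact (hmin l hl hkl h').elim

theorem firstReturn_ne {f : Perm E} {r : Setoid E} {x y : E} (h : r x y) (hne : x ≠ y)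
    (hxy : f.SameCycle x y) : firstReturn f r x ≠ x := by
  obtain ⟨k, hk, e, -, hmin⟩ := firstReturn_spec f r x
  obtain ⟨i, hi, rfl⟩ := sameCycle_iff_exists_lt_period.1 hxy
  intro h'
  have hp : Function.IsPeriodicPt f k x := by
    rw [Function.IsPeriodicPt, Function.IsFixedPt, Perm.iterate_eq_pow, ← e, h']
  have := hp.minimalPeriod_le hk
  have hi0 : i ≠ 0 := by
    rintro rfl
    exact hne rfl
  exact hmin i (by omega) (by omega) (r.symm h)

/-- A first return along `f⁻¹` is reread forwards: from the returned point, `f` reaches `x` along an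
arc with no equivalent point inside. This is the form needed to describe the side of a chord. -/
theorem firstReturn_inv_spec {f : Perm E} {r : Setoid E} {x : E} (h : firstReturn f⁻¹ r x ≠ x) :
    ∃ k, 0 < k ∧ k < Function.minimalPeriod f (firstReturn f⁻¹ r x) ∧
      (f ^ k) (firstReturn f⁻¹ r x) = x ∧
      ∀ i, 0 < i → i < k → ¬ r ((f ^ i) (firstReturn f⁻¹ r x)) x := by
  obtain ⟨k, hk, e, hr, hmin⟩ := firstReturn_spec f⁻¹ r x
  have hback : ∀ i ≤ k, (f ^ i) (firstReturn f⁻¹ r x) = (f⁻¹ ^ (k - i)) x := by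
    intro i hi
    rw [e, ← Perm.mul_apply]
    congr 1
    obtain ⟨j, rfl⟩ := Nat.exists_eq_add_of_le hi
    rw [pow_add, Nat.add_sub_cancel_left, inv_pow, inv_pow, mul_inv_cancel_left]
  refine ⟨k, hk, ?_, ?_, ?_⟩
  · by_contra hlt
    push Not at hlt
    have hp := period_pos f (firstReturn f⁻¹ r x)
    have h1 := hback _ hlt
    rw [pow_period] at h1
    rcases hlt.eq_or_lt with heq | hlt
    · rw [heq, Nat.sub_self] at h1
      exact h h1
    · refine hmin (k - Function.minimalPeriod f (firstReturn f⁻¹ r x)) (by omega) (by omega) ?_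
      rw [← h1]
      exact firstReturn_rel _ _ _
  · rw [hback k le_rfl, Nat.sub_self]
    rfl
  · intro i hi hik
    rw [hback i hik.le]
    exact hmin _ (by omega) (by omega)

/-- The equivalence relation in which `a` is removed from its class. -/
def isolate (r : Setoid E) (a : E) : Setoid E where
  r x y := x = y ∨ x ≠ a ∧ y ≠ a ∧ r x y
  iseqv := by
    refine ⟨fun x => Or.inl rfl, ?_, ?_⟩
    · rintro x y (h | ⟨h, h', h''⟩)
      · exact Or.inl h.symm
      · exact Or.inr ⟨h', h, r.symm h''⟩
    · rintro x y z (rfl | ⟨h, h', h''⟩) (rfl | ⟨k, k', k''⟩)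
      · exact Or.inl rfl
      · exact Or.inr ⟨k, k', k''⟩
      · exact Or.inr ⟨h, h', h''⟩
      · exact Or.inr ⟨h, k', r.trans h'' k''⟩

theorem firstReturnPerm_apply (f : Perm E) (r : Setoid E) (x : E) :
    firstReturnPerm f r x = firstReturn f r x := rfl

/-- Removing `a` from its class makes the point that returned to `a` skip to the next one, and fixes
`a`. A noncrossing identification can thus be built by one transposition at a time. -/
theorem firstReturnPerm_isolate [DecidableEq E] {f : Perm E} {r : Setoid E} {a : E}
    (ha : firstReturn f r a ≠ a) :
    firstReturnPerm f (isolate r a) = swap a (firstReturn f r a) * firstReturnPerm f r := by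
  ext x
  rw [Perm.mul_apply, firstReturnPerm_apply, firstReturnPerm_apply]
  rcases eq_or_ne x a with rfl | hxa
  · rw [swap_apply_right]
    rcases firstReturn_rel f (isolate r x) x with h | ⟨-, h, -⟩
    · exact h
    · exact (h rfl).elim
  obtain ⟨k, hk, e, hr, hmin⟩ := firstReturn_spec f r x
  rcases eq_or_ne (firstReturn f r x) a with hx | hx
  · rw [hx, swap_apply_left]
    obtain ⟨l, hl, e', hr', hmin'⟩ := firstReturn_spec f r a
    rw [hx] at e
    rw [← e] at hr
    have hadd : ∀ j, (f ^ (j + k)) x = (f ^ j) a := fun j => by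
      rw [pow_add, Perm.mul_apply, ← e]
    rw [e', ← hadd]
    apply firstReturn_eq (by omega)
    · rw [hadd, ← e']
      exact Or.inr ⟨ha, hxa, r.trans (firstReturn_rel f r a) hr⟩
    · intro j hj hjk h
      have h1 : (f ^ j) x ≠ a ∧ r ((f ^ j) x) x := by
        rcases h with h | ⟨h, -, h'⟩
        · rw [h]; exact ⟨hxa, r.refl x⟩
        · exact ⟨h, h'⟩
      rcases lt_trichotomy j k with hjk' | rfl | hjk'
      · exact hmin j hj hjk' h1.2
      · exact h1.1 e.symm
      · obtain ⟨i, rfl⟩ := Nat.exists_eq_add_of_lt hjk'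
        rw [show k + i + 1 = i + 1 + k by ring, hadd] at h1
        exact hmin' (i + 1) (by omega) (by omega) (r.trans h1.2 (r.symm hr))
  · have hne : firstReturn f r x ≠ firstReturn f r a := fun h =>
      hxa ((firstReturn_bijective f r).1 h)
    rw [swap_apply_of_ne_of_ne hx hne]
    conv_rhs => rw [e]
    rw [e] at hx
    apply firstReturn_eq hk (Or.inr ⟨hx, hxa, hr⟩)
    rintro j hj hjk (h | ⟨-, -, h⟩)
    · exact hmin j hj hjk (by rw [h])
    · exact hmin j hj hjk h

end FirstReturn

/-! ### Pinched faces and noncrossing identifications -/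

namespace EmbeddedMap

variable {d n : ℕ} {E : Type*} [Fintype E] [DecidableEq E]

/-- The edges of a blue face. -/
def faceSet (M : EmbeddedMap d n E) (B : M.BlueFace) : Set E := {x | Orbits.mk M.blue x = B}

theorem mem_faceSet {M : EmbeddedMap d n E} {B : M.BlueFace} {x : E} :
    x ∈ M.faceSet B ↔ Orbits.mk M.blue x = B := Iff.rfl

theorem mem_faceSet_iff {M : EmbeddedMap d n E} {B : M.BlueFace} {x y : E} (hx : x ∈ M.faceSet B) :
    y ∈ M.faceSet B ↔ M.blue.SameCycle x y := by
  rw [← Orbits.mk_eq_iff, mem_faceSet, mem_faceSet.1 hx, eq_comm]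

theorem sameCycle_of_mem {M : EmbeddedMap d n E} {B : M.BlueFace} {x y : E}
    (hx : x ∈ M.faceSet B) (hy : y ∈ M.faceSet B) : M.blue.SameCycle x y :=
  (mem_faceSet_iff hx).1 hy

theorem mem_faceSet_congr {M : EmbeddedMap d n E} {B : M.BlueFace} {x y : E}
    (h : M.blue.SameCycle x y) : y ∈ M.faceSet B ↔ x ∈ M.faceSet B :=
  ⟨fun hy => (mem_faceSet_iff hy).2 h.symm, fun hx => (mem_faceSet_iff hx).2 h⟩

theorem blue_mem_faceSet {M : EmbeddedMap d n E} {B : M.BlueFace} {x : E} :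
    M.blue x ∈ M.faceSet B ↔ x ∈ M.faceSet B :=
  mem_faceSet_congr (sameCycle_apply_self _ _)

theorem blue_inv_mem_faceSet {M : EmbeddedMap d n E} {B : M.BlueFace} {x : E} :
    M.blue⁻¹ x ∈ M.faceSet B ↔ x ∈ M.faceSet B := by
  rw [← blue_mem_faceSet, show M.blue (M.blue⁻¹ x) = x from M.blue.apply_symm_apply x]

/-- `β` describes the blue faces of a map obtained from `M` by splitting the blue face `B` along
identifications of its vertices. -/
structure IsPinched (M : EmbeddedMap d n E) (B : M.BlueFace) (β : Perm E) : Prop where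
  label_apply : ∀ x, M.label (β x) = (M.label x).symm
  off : ∀ x, x ∉ M.faceSet B → β x = M.blue x
  planar : PlanarPair M.blue β

variable {M : EmbeddedMap d n E} {B : M.BlueFace} {β : Perm E}

theorem isPinched_blue (M : EmbeddedMap d n E) (B : M.BlueFace) : M.IsPinched B M.blue := by
  refine ⟨M.label_blue, fun _ _ => rfl, ?_⟩
  unfold PlanarPair
  rw [mul_inv_cancel, cycleCount_one, conn, sup_idem]
  ring

namespace IsPinched

theorem sameCycle_blue (h : M.IsPinched B β) (x : E) : M.blue.SameCycle x (β x) := by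
  by_cases hx : x ∈ M.faceSet B
  · by_cases hy : β x ∈ M.faceSet B
    · exact sameCycle_of_mem hx hy
    · have h1 : M.blue⁻¹ (β x) ∉ M.faceSet B := fun k => hy (blue_inv_mem_faceSet.1 k)
      have h2 := h.off _ h1
      rw [show M.blue (M.blue⁻¹ (β x)) = β x from M.blue.apply_symm_apply _] at h2
      rw [β.injective h2] at h1
      exact (h1 hx).elim
  · rw [h.off x hx]; exact sameCycle_apply_self _ _

theorem cycles_le (h : M.IsPinched B β) : cycles β ≤ cycles M.blue :=
  cycles_le_iff.2 h.sameCycle_blue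

theorem apply_mem (h : M.IsPinched B β) {x : E} : β x ∈ M.faceSet B ↔ x ∈ M.faceSet B :=
  mem_faceSet_congr (h.sameCycle_blue x)

theorem conn_eq (h : M.IsPinched B β) : conn M.blue β = cycles M.blue :=
  sup_eq_left.2 h.cycles_le

/-- The cycles of `β * M.blue⁻¹` are the sets of corners that `β` identifies; identifications stay
within a blue face. -/
theorem vertex_le (h : M.IsPinched B β) : cycles (β * M.blue⁻¹) ≤ cycles M.blue := by
  refine (cycles_mul_inv_le_conn β M.blue).trans ?_
  rw [conn, sup_comm]
  exact h.conn_eq.le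

theorem label_vertex (h : M.IsPinched B β) {u v : E} (huv : (β * M.blue⁻¹).SameCycle u v) :
    M.label u = M.label v := by
  have : cycles (β * M.blue⁻¹) ≤ Setoid.ker M.label := by
    rw [cycles_le_iff]
    intro x
    rw [Setoid.ker_def, Perm.mul_apply, h.label_apply, ← M.label_blue,
      show M.blue (M.blue⁻¹ x) = x from M.blue.apply_symm_apply x]
  exact this huv

theorem mem_of_vertex_ne (h : M.IsPinched B β) {u v : E} (huv : (β * M.blue⁻¹).SameCycle u v)
    (hne : u ≠ v) : u ∈ M.faceSet B := by
  by_contra hu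
  have hfix : (β * M.blue⁻¹) u = u := by
    rw [Perm.mul_apply, h.off _ fun k => hu (blue_inv_mem_faceSet.1 k)]
    exact M.blue.apply_symm_apply u
  obtain ⟨i, rfl⟩ := huv
  exact hne (Perm.zpow_apply_eq_self_of_apply_eq_self hfix i).symm

/-- Splitting a face of `β`. -/
theorem swap_mul (h : M.IsPinched B β) {u v : E} (hu : u ∈ M.faceSet B) (huv : β.SameCycle u v)
    (hl : M.label u = M.label v) : M.IsPinched B (swap u v * β) := by
  have hv : v ∈ M.faceSet B := (mem_faceSet_congr (h.cycles_le huv)).2 hu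
  refine ⟨fun x => ?_, fun x hx => ?_, (h.planar.symm.swap_mul huv).symm⟩
  · rw [Perm.mul_apply, ← h.label_apply]
    rcases eq_or_ne (β x) u with k | k
    · rw [k, swap_apply_left, hl]
    rcases eq_or_ne (β x) v with k' | k'
    · rw [k', swap_apply_right, hl]
    · rw [swap_apply_of_ne_of_ne k k']
  · have hx' : β x ∉ M.faceSet B := fun k => hx (h.apply_mem.1 k)
    rw [Perm.mul_apply, swap_apply_of_ne_of_ne, h.off x hx] <;> rintro k <;> rw [k] at hx' <;>
      contradiction

/-- Undoing the identifications of one vertex. -/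
theorem unpinch (h : M.IsPinched B β) {a : E} (ha : a ∈ M.faceSet B) :
    M.IsPinched B (swap a (β (M.blue⁻¹ a)) * β) ∧
      (swap a (β (M.blue⁻¹ a)) * β).SameCycle a (β (M.blue⁻¹ a)) := by
  rcases eq_or_ne a (β (M.blue⁻¹ a)) with hac | hac
  · rw [← hac, swap_self, ← Perm.one_def, one_mul]
    exact ⟨h, Perm.SameCycle.refl _ _⟩
  set c := β (M.blue⁻¹ a) with hc
  have hθ : (β * M.blue⁻¹).SameCycle a c := sameCycle_apply_self (β * M.blue⁻¹) a
  have hcB : c ∈ M.faceSet B := (mem_faceSet_congr (h.vertex_le hθ)).2 ha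
  have hl : M.label a = M.label c := h.label_vertex hθ
  have hle : cycles (swap a c * β) ≤ cycles M.blue := by
    rw [cycles_le_iff]
    intro x
    have hx := h.sameCycle_blue x
    rw [Perm.mul_apply]
    rcases eq_or_ne (β x) a with k | k
    · rw [k] at hx; rw [k, swap_apply_left]
      exact hx.trans (sameCycle_of_mem ha hcB)
    rcases eq_or_ne (β x) c with k' | k'
    · rw [k'] at hx; rw [k', swap_apply_right]
      exact hx.trans (sameCycle_of_mem hcB ha)
    · rwa [swap_apply_of_ne_of_ne k k']
  -- The transposition fixes `a` in the vertex permutation, detaching it from the corners identified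
  -- with it.
  have e1 : cycleCount (swap a c * (β * M.blue⁻¹)) = cycleCount (β * M.blue⁻¹) + 1 :=
    classCount_swap_mul' hac hθ
  have hg := genus_nonneg (swap a c * β) M.blue
  have hp := h.planar.symm
  have hc1 : conn (swap a c * β) M.blue = cycles M.blue := sup_eq_right.2 hle
  have hc2 : conn β M.blue = cycles M.blue := sup_eq_right.2 h.cycles_le
  unfold PlanarPair at hp
  rw [hc1, mul_assoc] at hg
  rw [hc2] at hp
  -- The components are the cycles of `M.blue` before and after, so the gain of a vertex must be
  -- paid for by the merging of two faces.
  have hns : ¬ β.SameCycle a c := by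
    intro hs
    have e2 : cycleCount (swap a c * β) = cycleCount β + 1 := classCount_swap_mul' hac hs
    omega
  have e2 : cycleCount (swap a c * β) + 1 = cycleCount β := classCount_swap_mul hns
  refine ⟨⟨fun x => ?_, fun x hx => ?_, PlanarPair.symm ?_⟩, sameCycle_swap_mul hns⟩
  · rw [Perm.mul_apply, ← h.label_apply]
    rcases eq_or_ne (β x) a with k | k
    · rw [k, swap_apply_left, hl]
    rcases eq_or_ne (β x) c with k' | k'
    · rw [k', swap_apply_right, hl]
    · rw [swap_apply_of_ne_of_ne k k']
  · have hx' : β x ∉ M.faceSet B := fun k => hx (h.apply_mem.1 k)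
    rw [Perm.mul_apply, swap_apply_of_ne_of_ne, h.off x hx] <;> rintro k <;> rw [k] at hx' <;>
      contradiction
  · unfold PlanarPair
    rw [hc1, mul_assoc]
    omega

/-- Identified vertices split `B` into two parts that are preserved by `β`. -/
theorem apply_side (h : M.IsPinched B β) {u v : E} (hne : u ≠ v)
    (huv : (β * M.blue⁻¹).SameCycle u v) {x : E} (hx : x ∈ M.faceSet B) :
    (swap u v * M.blue).SameCycle x (β x) := by
  have hb := h.vertex_le huv
  have hu := h.mem_of_vertex_ne huv hne
  have huv' : (M.blue * β⁻¹).SameCycle u v := by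
    rw [← Perm.sameCycle_inv, mul_inv_rev, inv_inv]; exact huv
  -- In the planar pair `(M.blue, β)`, the corners `u` and `v` share a vertex, so cutting `B` along
  -- this chord separates them even when moves along `β` are allowed. Hence `β` cannot pass from one
  -- side to the other.
  have hn := h.planar.not_conn hne hb huv'
  have h1 := sameCycle_swap_mul_or hb (sameCycle_of_mem hu hx)
  have h2 := sameCycle_swap_mul_or hb (sameCycle_of_mem hu (h.apply_mem.2 hx))
  have hle := cycles_le_conn_left (swap u v * M.blue) β
  have h3 : conn (swap u v * M.blue) β x (β x) := conn_right _ _ _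
  rcases h1 with h1 | h1 <;> rcases h2 with h2 | h2
  · exact h1.trans h2.symm
  · exact (hn (Setoid.trans' _ (Setoid.symm' _ (hle h1)) (Setoid.trans' _ h3 (hle h2)))).elim
  · exact (hn (Setoid.trans' _ (Setoid.symm' _ (hle h2)) (Setoid.trans' _ (Setoid.symm' _ h3)
      (hle h1)))).elim
  · exact h1.trans h2.symm

end IsPinched

/-- Noncrossing identifications of the vertices of `B`. -/
structure IsNoncrossing (M : EmbeddedMap d n E) (B : M.BlueFace) (r : Setoid E) : Prop where
  mem : ∀ x y, r x y → x ≠ y → x ∈ M.faceSet B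
  label_eq : ∀ x y, r x y → M.label x = M.label y
  side : ∀ u v x y, u ≠ v → r u v → r x y → ¬ r u x → (swap u v * M.blue).SameCycle x y

/-- Cutting `B` along the chord from `u` to `v` disconnects the planar pair, while the vertex
containing `x` and `y` is untouched by the cut and remains connected. So `x` and `y` are on one
side. -/
theorem IsPinched.isNoncrossing (h : M.IsPinched B β) :
    M.IsNoncrossing B (cycles (β * M.blue⁻¹)) := by
  refine ⟨fun x y hxy hne => h.mem_of_vertex_ne hxy hne, fun x y hxy => h.label_vertex hxy, ?_⟩
  intro u v x y hne huv hxy hux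
  rcases eq_or_ne x y with rfl | hxy'
  · exact Perm.SameCycle.refl _ _
  have hb := h.vertex_le huv
  have hu := h.mem_of_vertex_ne huv hne
  have hx := h.mem_of_vertex_ne hxy hxy'
  have hy := h.mem_of_vertex_ne hxy.symm hxy'.symm
  have huv' : (M.blue * β⁻¹).SameCycle u v := by
    rw [← Perm.sameCycle_inv, mul_inv_rev, inv_inv]; exact huv
  have hn := h.planar.not_conn hne hb huv'
  have h1 := sameCycle_swap_mul_or hb (sameCycle_of_mem hu hx)
  have h2 := sameCycle_swap_mul_or hb (sameCycle_of_mem hu hy)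
  have hle := cycles_le_conn_left (swap u v * M.blue) β
  have h3 : conn (swap u v * M.blue) β x y := by
    apply cycles_mul_inv_le_conn
    rw [mul_assoc]
    have hxy2 : (M.blue * β⁻¹).SameCycle x y := by
      rw [← Perm.sameCycle_inv, mul_inv_rev, inv_inv]; exact hxy
    refine (sameCycle_congr_on (S := {z | (M.blue * β⁻¹).SameCycle x z}) (fun z hz => ?_)
      (Perm.SameCycle.refl _ _) hxy2).1
    have hz' : (M.blue * β⁻¹).SameCycle x ((M.blue * β⁻¹) z) :=
      Perm.SameCycle.trans hz (sameCycle_apply_self _ z)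
    refine ⟨?_, hz'⟩
    rw [Perm.mul_apply (swap u v), swap_apply_of_ne_of_ne]
    · intro k
      rw [k, ← Perm.sameCycle_inv, mul_inv_rev, inv_inv] at hz'
      exact hux hz'.symm
    · intro k
      rw [k, ← Perm.sameCycle_inv, mul_inv_rev, inv_inv] at hz'
      exact hux (huv.trans hz'.symm)
  rcases h1 with h1 | h1 <;> rcases h2 with h2 | h2
  · exact h1.trans h2.symm
  · exact (hn (Setoid.trans' _ (Setoid.symm' _ (hle h1)) (Setoid.trans' _ h3 (hle h2)))).elim
  · exact (hn (Setoid.trans' _ (Setoid.symm' _ (hle h2)) (Setoid.trans' _ (Setoid.symm' _ h3)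
      (hle h1)))).elim
  · exact h1.trans h2.symm

/-- A pinched face is determined by the identifications of its vertices. -/
theorem IsPinched.firstReturnPerm_eq (h : M.IsPinched B β) :
    firstReturnPerm M.blue⁻¹ (cycles (β * M.blue⁻¹)) * M.blue = β := by
  have key : ∀ u, firstReturn M.blue⁻¹ (cycles (β * M.blue⁻¹)) u = (β * M.blue⁻¹) u := by
    intro u
    have hw : (β * M.blue⁻¹).SameCycle (firstReturn M.blue⁻¹ (cycles (β * M.blue⁻¹)) u) u :=
      firstReturn_rel M.blue⁻¹ (cycles (β * M.blue⁻¹)) u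
    have hv : (β * M.blue⁻¹).SameCycle u ((β * M.blue⁻¹) u) := sameCycle_apply_self _ _
    rcases eq_or_ne ((β * M.blue⁻¹) u) u with hfix | hne
    · obtain ⟨i, hi⟩ := hw.symm
      rw [← hi, hfix]
      exact Perm.zpow_apply_eq_self_of_apply_eq_self hfix i
    have hwu : firstReturn M.blue⁻¹ (cycles (β * M.blue⁻¹)) u ≠ u :=
      firstReturn_ne hv hne.symm (Perm.sameCycle_inv.2 (h.vertex_le hv))
    obtain ⟨k, hk, hkp, hku, hmin⟩ := firstReturn_inv_spec hwu
    set w := firstReturn M.blue⁻¹ (cycles (β * M.blue⁻¹)) u with hwdef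
    have huB : u ∈ M.faceSet B := h.mem_of_vertex_ne hv hne.symm
    -- The arc from `w` up to the corner before `u` meets the class of `u` only in `w`. The image of
    -- `u` stays on that arc because it is on the side of `M.blue⁻¹ u`, and it is identified with
    -- `u`, so it is `w`.
    have hside := h.apply_side hwu hw (blue_inv_mem_faceSet.2 huB)
    have hpre : (swap w u * M.blue).SameCycle w (M.blue⁻¹ u) := by
      rw [← hku, sameCycle_swap_mul_pow_iff hkp hk]
      refine ⟨k - 1, by omega, ?_⟩
      obtain ⟨m, rfl⟩ : ∃ m, k = m + 1 := ⟨k - 1, by omega⟩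
      rw [pow_succ', Perm.mul_apply, Nat.add_sub_cancel]
      exact (M.blue.symm_apply_apply _).symm
    have hfin := hpre.trans hside
    change (swap w u * M.blue).SameCycle w ((β * M.blue⁻¹) u) at hfin
    have hiff := sameCycle_swap_mul_pow_iff (y := (β * M.blue⁻¹) u) hkp hk
    rw [hku] at hiff
    obtain ⟨i, hi, e⟩ := hiff.1 hfin
    rcases Nat.eq_zero_or_pos i with rfl | hi0
    · exact e
    · refine (hmin i hi0 hi ?_).elim
      rw [e]
      exact hv.symm
  ext x
  rw [Perm.mul_apply, firstReturnPerm_apply, key, Perm.mul_apply]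
  simp

theorem IsNoncrossing.isolate {r : Setoid E} (h : M.IsNoncrossing B r) (a : E) :
    M.IsNoncrossing B (isolate r a) := by
  refine ⟨?_, ?_, ?_⟩
  · rintro x y (rfl | ⟨-, -, hxy⟩) hne
    · exact (hne rfl).elim
    · exact h.mem x y hxy hne
  · rintro x y (rfl | ⟨-, -, hxy⟩)
    · rfl
    · exact h.label_eq x y hxy
  · rintro u v x y hne (rfl | ⟨hu, hv, huv⟩) (rfl | ⟨hx, hy, hxy⟩) hux
    · exact (hne rfl).elim
    · exact (hne rfl).elim
    · exact Perm.SameCycle.refl _ _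
    · exact h.side u v x y hne huv hxy fun k => hux (Or.inr ⟨hu, hx, k⟩)

/-- Performing noncrossing identifications. -/
theorem IsNoncrossing.isPinched {r : Setoid E} (h : M.IsNoncrossing B r) :
    M.IsPinched B (firstReturnPerm M.blue⁻¹ r * M.blue) := by
  classical
  induction hs : (Finset.univ.filter fun x => ∃ y, r x y ∧ x ≠ y).card using
    Nat.strong_induction_on generalizing r with | _ N ih
  by_cases hr : ∃ a y, r a y ∧ a ≠ y
  swap
  · push Not at hr
    have : firstReturnPerm M.blue⁻¹ r = 1 := by
      ext x
      exact hr _ _ (firstReturn_rel M.blue⁻¹ r x)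
    rw [this, one_mul]
    exact isPinched_blue M B
  obtain ⟨a, y, hay, hne⟩ := hr
  have haB := h.mem a y hay hne
  have hyB := h.mem y a (r.symm hay) hne.symm
  have hc : firstReturn M.blue⁻¹ r a ≠ a :=
    firstReturn_ne hay hne (Perm.sameCycle_inv.2 (sameCycle_of_mem haB hyB))
  have hca := firstReturn_rel M.blue⁻¹ r a
  have hθ : firstReturnPerm M.blue⁻¹ r a = firstReturn M.blue⁻¹ r a := rfl
  have hiso := firstReturnPerm_isolate hc
  obtain ⟨k, hk, hkp, hka, hmin⟩ := firstReturn_inv_spec hc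
  set c := firstReturn M.blue⁻¹ r a with hcdef
  -- Induction on the number of corners identified with another one: `a` is isolated, and one
  -- splitting reattaches it.
  have ih' : M.IsPinched B (firstReturnPerm M.blue⁻¹ (SurfaceSum.isolate r a) * M.blue) := by
    refine ih _ (hs ▸ Finset.card_lt_card ?_) (h.isolate a) rfl
    rw [Finset.ssubset_iff_of_subset]
    · refine ⟨a, by simpa using ⟨y, hay, hne⟩, ?_⟩
      rw [Finset.mem_filter]
      rintro ⟨-, z, hz | ⟨hz, -⟩, hz'⟩
      · exact hz' hz
      · exact hz rfl
    · intro x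
      simp only [Finset.mem_filter, Finset.mem_univ, true_and]
      rintro ⟨z, hz | ⟨-, -, hz⟩, hz'⟩
      · exact (hz' hz).elim
      · exact ⟨z, hz, hz'⟩
  -- The arc of `B` from `c` up to the edge before `a` is invariant: the edge ending at `a` is sent
  -- back to `c`, and no other class crosses the chord. So `a` and `c` end in different faces, which
  -- the transposition of `a` and `c` merges.
  have hns : ¬ (firstReturnPerm M.blue⁻¹ r * M.blue).SameCycle a c := by
    have hcB := h.mem c a hca hc
    have hsep := not_sameCycle_swap_mul hc (sameCycle_of_mem hcB haB)
    intro hac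
    refine hsep (sameCycle_congr_on (f := firstReturnPerm M.blue⁻¹ r * M.blue)
      (g := firstReturnPerm M.blue⁻¹ r * M.blue)
      (S := {x | (swap c a * M.blue).SameCycle c x}) (fun x hx => ⟨rfl, ?_⟩)
      (Perm.SameCycle.refl _ _) hac.symm).2
    have hgx : (swap c a * M.blue).SameCycle c ((swap c a * M.blue) x) :=
      Perm.SameCycle.trans hx (sameCycle_apply_self _ _)
    rw [Perm.mul_apply] at hgx
    rw [Set.mem_ofPred_eq, Perm.mul_apply]
    rcases eq_or_ne (M.blue x) a with h1 | h1
    · rw [h1, hθ]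
    rcases eq_or_ne (M.blue x) c with h2 | h2
    · rw [h2, swap_apply_left] at hgx
      exact (hsep hgx).elim
    rw [swap_apply_of_ne_of_ne h2 h1] at hgx
    refine hgx.trans ?_
    have hz : r (M.blue x) (firstReturnPerm M.blue⁻¹ r (M.blue x)) :=
      r.symm (firstReturn_rel _ _ _)
    refine h.side c a _ _ hc hca hz fun hcz => ?_
    have hiff := sameCycle_swap_mul_pow_iff (y := M.blue x) hkp hk
    rw [hka] at hiff
    obtain ⟨i, hi, e⟩ := hiff.1 hgx
    rcases Nat.eq_zero_or_pos i with rfl | hi0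
    · exact h2 e.symm
    · refine hmin i hi0 hi ?_
      rw [e]
      exact r.trans (r.symm hcz) hca
  have hsplit := sameCycle_swap_mul hns
  rw [← mul_assoc, ← hiso] at hsplit
  have := ih'.swap_mul haB hsplit (h.label_eq _ _ hca).symm
  rwa [hiso, mul_assoc, swap_mul_self_mul] at this

end EmbeddedMap

end SurfaceSum

namespace SurfaceSum

/-! ### Feasible collections and noncrossing identifications -/

namespace EmbeddedMap

variable {d n : ℕ} {E : Type*} [Fintype E] [DecidableEq E]
variable {M : EmbeddedMap d n E} {B : M.BlueFace} {β : Perm E}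

/-- A class generated by chords that each avoid crossing `u v` lies on one side of it. The
generators coming from two crossing pinchings do no harm, since crossing chords cannot lie on
different sides of a third one. -/
theorem FeasibleCollection.side_of_pairs (P : M.FeasibleCollection B) {u v : E}
    (hu : u ∈ M.faceSet B) (hv : v ∈ M.faceSet B)
    (hpair : ∀ x y, s(x, y) ∈ P.pairs → ¬ M.identification P.pairs u x →
      (swap u v * M.blue).SameCycle x y) {x y : E} (hxy : M.identification P.pairs x y)
    (hux : ¬ M.identification P.pairs u x) : (swap u v * M.blue).SameCycle x y := by
  induction (show Relation.EqvGen _ x y from hxy) with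
  | rel a a' hr =>
    have haa' : M.identification P.pairs a a' := Relation.EqvGen.rel _ _ hr
    rcases hr with h | ⟨w, w', h, h', hp⟩
    · exact hpair a a' h hux
    · by_contra hside
      refine hp ?_
      have ha := P.isPinching _ _ h
      have ha' := P.isPinching _ _ h'
      exact sameCycle_swap_mul_of_sides (sameCycle_of_mem hu hv) (sameCycle_of_mem hu ha.1)
        (sameCycle_of_mem hu ha.2.1) (sameCycle_of_mem hu ha'.1) (sameCycle_of_mem hu ha'.2.1)
        (hpair _ _ h hux)
        (hpair _ _ h' fun k => hux ((M.identification P.pairs).trans k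
          ((M.identification P.pairs).symm haa'))) hside
  | refl a => exact Perm.SameCycle.refl _ _
  | symm a a' h ih =>
    exact (ih h fun k => hux ((M.identification P.pairs).trans k h)).symm
  | trans a a' a'' h h' ih ih' =>
    exact (ih h hux).trans (ih' h' fun k => hux ((M.identification P.pairs).trans k
      ((M.identification P.pairs).symm h)))

theorem FeasibleCollection.mem_of_identification (P : M.FeasibleCollection B) {x y : E}
    (hxy : M.identification P.pairs x y) : x = y ∨ x ∈ M.faceSet B ∧ y ∈ M.faceSet B := by
  induction (show Relation.EqvGen _ x y from hxy) with
  | rel a a' hr =>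
    rcases hr with h | ⟨w, w', h, h', hp⟩
    · exact Or.inr ⟨(P.isPinching _ _ h).1, (P.isPinching _ _ h).2.1⟩
    · exact Or.inr ⟨(P.isPinching _ _ h).1, (P.isPinching _ _ h').1⟩
  | refl a => exact Or.inl rfl
  | symm a a' h ih => exact (ih h).imp Eq.symm And.symm
  | trans a a' a'' h h' ih ih' =>
    rcases ih h with rfl | k
    · exact ih' h'
    · rcases ih' h' with rfl | k'
      · exact Or.inr k
      · exact Or.inr ⟨k.1, k'.2⟩

theorem FeasibleCollection.isNoncrossing (P : M.FeasibleCollection B) :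
    M.IsNoncrossing B (M.identification P.pairs) := by
  have hmem : ∀ x y, M.identification P.pairs x y → x ≠ y → x ∈ M.faceSet B :=
    fun x y h hne => ((P.mem_of_identification h).resolve_left hne).1
  -- For a chord of the collection itself, a crossing chord would belong to the same class by the
  -- definition of `identification`.
  have hchord : ∀ u v, s(u, v) ∈ P.pairs → ∀ x y, M.identification P.pairs x y →
      ¬ M.identification P.pairs u x → (swap u v * M.blue).SameCycle x y := by
    intro u v huv x y hxy hux
    have hp := P.isPinching _ _ huv
    refine P.side_of_pairs hp.1 hp.2.1 (fun a a' h hua => ?_) hxy hux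
    by_contra hP
    exact hua (Relation.EqvGen.rel _ _ (Or.inr ⟨v, a', huv, h, hP⟩))
  refine ⟨hmem, fun x y h => P.label_eq h, ?_⟩
  intro u v x y hne huv hxy hux
  have hu := hmem u v huv hne
  have hv := hmem v u ((M.identification P.pairs).symm huv) hne.symm
  have hvx : ∀ z, M.identification P.pairs x z → u ≠ z ∧ v ≠ z := by
    intro z hz
    constructor
    · rintro rfl
      exact hux ((M.identification P.pairs).symm hz)
    · rintro rfl
      exact hux ((M.identification P.pairs).trans huv ((M.identification P.pairs).symm hz))
  refine P.side_of_pairs hu hv (fun a a' h hua => ?_) hxy hux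
  have hp := P.isPinching _ _ h
  have haa' : M.identification P.pairs a a' := Relation.EqvGen.rel _ _ (Or.inl h)
  have hua' : ¬ M.identification P.pairs u a' := fun k =>
    hua ((M.identification P.pairs).trans k ((M.identification P.pairs).symm haa'))
  have hne' : ∀ z, ¬ M.identification P.pairs u z → u ≠ z ∧ v ≠ z := by
    intro z hz
    constructor
    · rintro rfl
      exact hz ((M.identification P.pairs).refl u)
    · rintro rfl
      exact hz huv
  -- A general chord `u v` is compared with a pinching `a a'` by symmetry of crossing: the class
  -- containing `u` and `v` is on one side of `a a'`.
  exact sameCycle_swap_mul_comm (sameCycle_of_mem hp.1 hp.2.1) (sameCycle_of_mem hp.1 hu)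
    (sameCycle_of_mem hu hv) (hne' a hua).1.symm (hne' a hua).2.symm (hne' a' hua').1.symm
    (hne' a' hua').2.symm
    (hchord a a' h u v huv fun k => hua ((M.identification P.pairs).symm k))

theorem isPinched_perform (P : M.FeasibleCollection B) : M.IsPinched B (M.perform P).blue :=
  P.isNoncrossing.isPinched

/-- The collection of all the pinchings prescribed by a noncrossing identification. -/
def IsNoncrossing.collection {r : Setoid E} (h : M.IsNoncrossing B r) :
    M.FeasibleCollection B where
  pairs := {z | ∃ u v, z = s(u, v) ∧ u ≠ v ∧ r u v}
  isPinching := by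
    rintro u v ⟨u', v', e, hne, huv⟩
    have hu := h.mem _ _ huv hne
    have hv := h.mem _ _ (r.symm huv) hne.symm
    rcases Sym2.eq_iff.1 e with ⟨rfl, rfl⟩ | ⟨rfl, rfl⟩
    · exact ⟨hu, hv, hne, h.label_eq _ _ huv⟩
    · exact ⟨hv, hu, hne.symm, (h.label_eq _ _ huv).symm⟩
  feasible := by
    rintro u v x y ⟨u', v', e, hne, huv⟩ ⟨x', y', e', hne', hxy⟩ hl
    have hu : u ≠ v ∧ r u v := by
      rcases Sym2.eq_iff.1 e with ⟨rfl, rfl⟩ | ⟨rfl, rfl⟩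
      · exact ⟨hne, huv⟩
      · exact ⟨hne.symm, r.symm huv⟩
    have hx : x ≠ y ∧ r x y := by
      rcases Sym2.eq_iff.1 e' with ⟨rfl, rfl⟩ | ⟨rfl, rfl⟩
      · exact ⟨hne', hxy⟩
      · exact ⟨hne'.symm, r.symm hxy⟩
    exact not_not.2 (h.side u v x y hu.1 hu.2 hx.2 fun k => hl (h.label_eq _ _ k))

theorem IsNoncrossing.mem_collection {r : Setoid E} (h : M.IsNoncrossing B r) {u v : E} :
    s(u, v) ∈ h.collection.pairs ↔ u ≠ v ∧ r u v := by
  constructor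
  · rintro ⟨u', v', e, hne, huv⟩
    rcases Sym2.eq_iff.1 e with ⟨rfl, rfl⟩ | ⟨rfl, rfl⟩
    · exact ⟨hne, huv⟩
    · exact ⟨hne.symm, r.symm huv⟩
  · exact fun k => ⟨u, v, rfl, k⟩

/-- The clause that merges crossing pinchings adds nothing, because crossing chords of a noncrossing
relation are already in one class. -/
theorem IsNoncrossing.identification_collection {r : Setoid E} (h : M.IsNoncrossing B r) :
    M.identification h.collection.pairs = r := by
  apply le_antisymm
  · refine Setoid.eqvGen_le ?_
    rintro x y (hxy | ⟨x', y', hx, hy, hp⟩)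
    · exact (h.mem_collection.1 hxy).2
    · by_contra hxy
      rw [h.mem_collection] at hx hy
      exact hp (h.side _ _ _ _ hx.1 hx.2 hy.2 hxy)
  · intro x y hxy
    rcases eq_or_ne x y with rfl | hne
    · exact Setoid.refl' _ _
    · exact Relation.EqvGen.rel _ _ (Or.inl (h.mem_collection.2 ⟨hne, hxy⟩))

/-- Every pinched face comes from a feasible collection of pinchings. -/
theorem IsPinched.exists_perform (h : M.IsPinched B β) :
    ∃ P : M.FeasibleCollection B, (M.perform P).blue = β := by
  refine ⟨h.isNoncrossing.collection, ?_⟩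
  change firstReturnPerm M.blue⁻¹ (M.identification h.isNoncrossing.collection.pairs) * M.blue = β
  rw [h.isNoncrossing.identification_collection, h.firstReturnPerm_eq]

end EmbeddedMap

end SurfaceSum

/-! ### Separability in terms of permutations -/

namespace SurfaceSum

/-- A walk through faces is turned into a chain of edges. The abstract graph covers both the dual
graph and its induced subgraphs. -/
theorem rel_of_reachable {E W : Type*} {G : SimpleGraph W} {on : W → E → Prop} {t : Setoid E}
    (h1 : ∀ F x x', on F x → on F x' → t x x') (h2 : ∀ F F', G.Adj F F' → ∃ x, on F x ∧ on F' x)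
    {F F' : W} (h : G.Reachable F F') {x x' : E} (hx : on F x) (hx' : on F' x') : t x x' := by
  obtain ⟨p⟩ := h
  induction p generalizing x with
  | nil => exact h1 _ _ _ hx hx'
  | cons hadj p ih =>
    obtain ⟨z, hz, hz'⟩ := h2 _ _ hadj
    exact t.trans (h1 _ _ _ hx hz) (ih hz' hx')

namespace EmbeddedMap

variable {d n : ℕ} {E : Type*} [Fintype E] [DecidableEq E]

/-- The edges sent to the lattice edge `e`. -/
def labelSet (M : EmbeddedMap d n E) (e : Sym2 (Fin d → ℤ)) : Set E := {x | (M.label x).edge = e}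

theorem mem_labelSet {M : EmbeddedMap d n E} {e : Sym2 (Fin d → ℤ)} {x : E} :
    x ∈ M.labelSet e ↔ (M.label x).edge = e := Iff.rfl

theorem apply_mem_labelSet {M : EmbeddedMap d n E} {β : Perm E}
    (h : ∀ x, M.label (β x) = (M.label x).symm) (e : Sym2 (Fin d → ℤ)) (x : E) :
    β x ∈ M.labelSet e ↔ x ∈ M.labelSet e := by
  rw [mem_labelSet, mem_labelSet, h, SimpleGraph.Dart.edge_symm]

/-- The edge `x` is on the boundary of the face `F`. -/
def OnFace (M : EmbeddedMap d n E) (F : M.BlueFace ⊕ M.YellowFace) (x : E) : Prop :=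
  F = Sum.inl (Orbits.mk M.blue x) ∨ F = Sum.inr (Orbits.mk M.yellow x)

theorem exists_onFace (M : EmbeddedMap d n E) (F : M.BlueFace ⊕ M.YellowFace) :
    ∃ x, M.OnFace F x := by
  rcases F with F | F
  · obtain ⟨x, rfl⟩ := Quotient.exists_rep F
    exact ⟨x, Or.inl rfl⟩
  · obtain ⟨x, rfl⟩ := Quotient.exists_rep F
    exact ⟨x, Or.inr rfl⟩

theorem exists_onFace_of_adj {M : EmbeddedMap d n E} {F G : M.BlueFace ⊕ M.YellowFace}
    (h : M.dualGraph.Adj F G) : ∃ x, M.OnFace F x ∧ M.OnFace G x := by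
  rcases ((SimpleGraph.fromRel_adj _ _ _).1 h).2 with ⟨x, h1, h2⟩ | ⟨x, h1, h2⟩
  · exact ⟨x, Or.inl h1, Or.inr h2⟩
  · exact ⟨x, Or.inr h2, Or.inl h1⟩

theorem dualGraph_adj (M : EmbeddedMap d n E) (x : E) :
    M.dualGraph.Adj (Sum.inl (Orbits.mk M.blue x)) (Sum.inr (Orbits.mk M.yellow x)) :=
  (SimpleGraph.fromRel_adj _ _ _).2 ⟨Sum.inl_ne_inr, Or.inl ⟨x, rfl, rfl⟩⟩

theorem rel_of_onFace {M : EmbeddedMap d n E} {F : M.BlueFace ⊕ M.YellowFace} {x x' : E}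
    (hx : M.OnFace F x) (hx' : M.OnFace F x') : conn M.blue M.yellow x x' := by
  rcases hx with rfl | rfl <;> rcases hx' with h | h
  · exact cycles_le_conn_left _ _ (Orbits.mk_eq_iff.1 (Sum.inl_injective h))
  · simp at h
  · simp at h
  · exact cycles_le_conn_right _ _ (Orbits.mk_eq_iff.1 (Sum.inr_injective h))

theorem rel_of_onFace_of_mem {M : EmbeddedMap d n E} {e : Sym2 (Fin d → ℤ)}
    {F : M.BlueFace ⊕ M.YellowFace} (hF : F ∈ M.remainingFaces e) {x x' : E}
    (hx : M.OnFace F x) (hx' : M.OnFace F x') :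
    conn (collapse M.blue (M.labelSet e)) M.yellow x x' := by
  rcases hx with rfl | rfl <;> rcases hx' with h | h
  · have hmem := apply_mem_labelSet M.label_blue e
    refine cycles_le_conn_left _ _ (sameCycle_congr_on (f := M.blue) (S := (M.labelSet e)ᶜ)
      (fun z hz => ⟨(collapse_of_notMem hmem hz).symm, fun k => hz ((hmem z).1 k)⟩)
      (hF x rfl) (Orbits.mk_eq_iff.1 (Sum.inl_injective h))).1
  · simp at h
  · simp at h
  · exact cycles_le_conn_right _ _ (Orbits.mk_eq_iff.1 (Sum.inr_injective h))

theorem inr_mem_remainingFaces (M : EmbeddedMap d n E) (e : Sym2 (Fin d → ℤ)) (F : M.YellowFace) :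
    Sum.inr F ∈ M.remainingFaces e := fun _ h => (Sum.inr_ne_inl h).elim

theorem reachable_of_conn {M : EmbeddedMap d n E} {x x' : E} (h : conn M.blue M.yellow x x') :
    M.dualGraph.Reachable (Sum.inr (Orbits.mk M.yellow x)) (Sum.inr (Orbits.mk M.yellow x')) := by
  have : conn M.blue M.yellow ≤ Setoid.comap
      (fun x => (Sum.inr (Orbits.mk M.yellow x) : M.BlueFace ⊕ M.YellowFace))
      M.dualGraph.reachableSetoid := by
    refine conn_le_iff.2 ⟨fun z => ?_, fun z => ?_⟩
    · have h1 := M.dualGraph_adj z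
      rw [Orbits.mk_eq_iff.2 (sameCycle_apply_self M.blue z)] at h1
      exact h1.symm.reachable.trans (M.dualGraph_adj (M.blue z)).reachable
    · have : Orbits.mk M.yellow z = Orbits.mk M.yellow (M.yellow z) :=
        Orbits.mk_eq_iff.2 (sameCycle_apply_self M.yellow z)
      rw [Setoid.comap_rel, ← this]
  exact this h

theorem induce_reachable_of_conn {M : EmbeddedMap d n E} {e : Sym2 (Fin d → ℤ)} {x x' : E}
    (h : conn (collapse M.blue (M.labelSet e)) M.yellow x x') :
    (M.dualGraph.induce (M.remainingFaces e)).Reachable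
      ⟨Sum.inr (Orbits.mk M.yellow x), M.inr_mem_remainingFaces e _⟩
      ⟨Sum.inr (Orbits.mk M.yellow x'), M.inr_mem_remainingFaces e _⟩ := by
  have : conn (collapse M.blue (M.labelSet e)) M.yellow ≤ Setoid.comap
      (fun x => (⟨Sum.inr (Orbits.mk M.yellow x), M.inr_mem_remainingFaces e _⟩ :
        M.remainingFaces e)) (M.dualGraph.induce (M.remainingFaces e)).reachableSetoid := by
    have hmem := apply_mem_labelSet M.label_blue e
    refine conn_le_iff.2 ⟨fun z => ?_, fun z => ?_⟩
    · by_cases hz : z ∈ M.labelSet e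
      · rw [collapse_of_mem hmem hz]
      rw [collapse_of_notMem hmem hz]
      have h0 : Orbits.mk M.blue z = Orbits.mk M.blue (M.blue z) :=
        Orbits.mk_eq_iff.2 (sameCycle_apply_self M.blue z)
      have hF : Sum.inl (Orbits.mk M.blue z) ∈ M.remainingFaces e := by
        intro w hw hwe
        have hzw := Orbits.mk_eq_iff.1 (Sum.inl_injective hw)
        have := (sameCycle_congr_on (f := M.blue) (g := M.blue) (S := (M.labelSet e)ᶜ)
          (fun z hz => ⟨rfl, fun k => hz ((hmem z).1 k)⟩) hz hzw).2
        exact this hwe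
      have h1 : (M.dualGraph.induce (M.remainingFaces e)).Adj ⟨_, hF⟩
          ⟨_, M.inr_mem_remainingFaces e (Orbits.mk M.yellow z)⟩ := M.dualGraph_adj z
      have h2 : (M.dualGraph.induce (M.remainingFaces e)).Adj ⟨_, hF⟩
          ⟨_, M.inr_mem_remainingFaces e (Orbits.mk M.yellow (M.blue z))⟩ := by
        have := M.dualGraph_adj (M.blue z)
        rw [← h0] at this
        exact this
      exact h1.symm.reachable.trans h2.reachable
    · have : Orbits.mk M.yellow z = Orbits.mk M.yellow (M.yellow z) :=
        Orbits.mk_eq_iff.2 (sameCycle_apply_self M.yellow z)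
      simp only [Setoid.comap_rel, ← this]
      exact SimpleGraph.Reachable.refl _
  exact this h

/-- The map with blue faces given by `β` is non-separable: collapsing the blue faces sent to any
lattice edge does not disconnect it. -/
def IsValid (M : EmbeddedMap d n E) (β : Perm E) : Prop :=
  ∀ e ∈ (latticeGraph d).edgeSet,
    conn β M.yellow ≤ conn (collapse β (M.labelSet e)) M.yellow

/-- Deleting a blue face amounts to making its edges fixed points, which then connect nothing.
Yellow faces are never deleted, and every remaining face is adjacent or equal to the yellow face of
each of its edges, so it suffices to compare yellow faces. -/
theorem nonSeparable_iff (M : EmbeddedMap d n E) : M.NonSeparable ↔ M.IsValid M.blue := by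
  constructor
  · intro h e he x x' hxx'
    refine rel_of_reachable (on := fun (F : M.remainingFaces e) x => M.OnFace F.1 x)
      (fun F x x' hx hx' => rel_of_onFace_of_mem F.2 hx hx')
      (fun F F' hadj => exists_onFace_of_adj hadj)
      (h e he ⟨_, M.inr_mem_remainingFaces e (Orbits.mk M.yellow x)⟩
        ⟨_, M.inr_mem_remainingFaces e (Orbits.mk M.yellow x')⟩ (reachable_of_conn hxx'))
      (Or.inr rfl) (Or.inr rfl)
  · intro h e he F G hFG
    have hto : ∀ F : M.remainingFaces e, ∀ x, M.OnFace F.1 x →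
        (M.dualGraph.induce (M.remainingFaces e)).Reachable F
          ⟨_, M.inr_mem_remainingFaces e (Orbits.mk M.yellow x)⟩ := by
      rintro ⟨F, hF⟩ x (rfl | rfl)
      · exact SimpleGraph.Adj.reachable (M.dualGraph_adj x)
      · exact SimpleGraph.Reachable.refl _
    obtain ⟨x, hx⟩ := M.exists_onFace F.1
    obtain ⟨x', hx'⟩ := M.exists_onFace G.1
    have hc : conn M.blue M.yellow x x' :=
      rel_of_reachable (on := M.OnFace) (fun F x x' hx hx' => rel_of_onFace hx hx')
        (fun F F' hadj => exists_onFace_of_adj hadj) hFG hx hx'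
    exact (hto F x hx).trans ((induce_reachable_of_conn (h e he hc)).trans (hto G x' hx').symm)

theorem perform_nonSeparable_iff {M : EmbeddedMap d n E} {B : M.BlueFace}
    (P : M.FeasibleCollection B) :
    (M.perform P).NonSeparable ↔ M.IsValid (M.perform P).blue :=
  (M.perform P).nonSeparable_iff

variable {M : EmbeddedMap d n E} {B : M.BlueFace} {β : Perm E}

theorem label_edge_eq_of_mem {x y : E} (hx : x ∈ M.faceSet B) (hy : y ∈ M.faceSet B) :
    (M.label x).edge = (M.label y).edge := by
  have : cycles M.blue ≤ Setoid.ker fun x => (M.label x).edge :=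
    cycles_le_iff.2 fun z => by
      rw [Setoid.ker_def, M.label_blue, SimpleGraph.Dart.edge_symm]
  exact this (sameCycle_of_mem hx hy)

theorem label_eq_or_symm_of_mem {x y : E} (hx : x ∈ M.faceSet B) (hy : y ∈ M.faceSet B) :
    M.label y = M.label x ∨ M.label y = (M.label x).symm :=
  SimpleGraph.dart_edge_eq_iff _ _ |>.1 (label_edge_eq_of_mem hy hx)

theorem IsPinched.conn_yellow_le (h : M.IsPinched B β) :
    conn β M.yellow ≤ conn M.blue M.yellow :=
  sup_le_sup_right h.cycles_le _

/-- The part of the connections of the map that uses neither the blue faces sent to `e`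
nor `B`. -/
noncomputable abbrev outerConn (M : EmbeddedMap d n E) (B : M.BlueFace)
    (e : Sym2 (Fin d → ℤ)) : Setoid E :=
  conn (collapse M.blue (M.labelSet e ∪ M.faceSet B)) M.yellow

theorem outer_invariant (M : EmbeddedMap d n E) (B : M.BlueFace) (e : Sym2 (Fin d → ℤ)) (x : E) :
    M.blue x ∈ M.labelSet e ∪ M.faceSet B ↔ x ∈ M.labelSet e ∪ M.faceSet B :=
  or_congr (apply_mem_labelSet M.label_blue e x) blue_mem_faceSet

theorem IsPinched.outerConn_le (h : M.IsPinched B β) (e : Sym2 (Fin d → ℤ)) :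
    M.outerConn B e ≤ conn (collapse β (M.labelSet e)) M.yellow := by
  refine conn_le_iff.2 ⟨fun x => ?_, conn_right _ _⟩
  by_cases hx : x ∈ M.labelSet e ∪ M.faceSet B
  · rw [collapse_of_mem (M.outer_invariant B e) hx]
  · rw [collapse_of_notMem (M.outer_invariant B e) hx, ← h.off x fun k => hx (Or.inr k),
      ← collapse_of_notMem (apply_mem_labelSet h.label_apply e) fun k => hx (Or.inl k)]
    exact conn_left _ _ _

/-- Removing all faces over the lattice edge of `B` erases every trace of the pinching. -/
theorem IsPinched.collapse_eq (h : M.IsPinched B β) {o : E} (ho : o ∈ M.faceSet B) :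
    collapse β (M.labelSet (M.label o).edge) = collapse M.blue (M.labelSet (M.label o).edge) := by
  ext x
  by_cases hx : x ∈ M.labelSet (M.label o).edge
  · rw [collapse_of_mem (apply_mem_labelSet h.label_apply _) hx,
      collapse_of_mem (apply_mem_labelSet M.label_blue _) hx]
  · rw [collapse_of_notMem (apply_mem_labelSet h.label_apply _) hx,
      collapse_of_notMem (apply_mem_labelSet M.label_blue _) hx]
    exact h.off x fun k => hx (label_edge_eq_of_mem k ho)

/-- Non-separability of `M` keeps its components connected without `B`, so pinching `B` cannot
disconnect them. -/
theorem IsPinched.conn_yellow_eq (h : M.IsPinched B β) (hM : M.IsValid M.blue) {o : E}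
    (ho : o ∈ M.faceSet B) : conn β M.yellow = conn M.blue M.yellow := by
  refine le_antisymm h.conn_yellow_le ((hM _ (M.label o).edge_mem).trans ?_)
  rw [← h.collapse_eq ho]
  refine conn_le_iff.2 ⟨fun x => ?_, conn_right _ _⟩
  by_cases hx : x ∈ M.labelSet (M.label o).edge
  · rw [collapse_of_mem (apply_mem_labelSet h.label_apply _) hx]
  · rw [collapse_of_notMem (apply_mem_labelSet h.label_apply _) hx]
    exact conn_left _ _ _

/-- Only the lattice edges other than that of `B` matter for the separability of a pinched map. -/
theorem IsPinched.isValid_iff (h : M.IsPinched B β) (hM : M.IsValid M.blue) {o : E}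
    (ho : o ∈ M.faceSet B) : M.IsValid β ↔ ∀ e ∈ (latticeGraph d).edgeSet, (M.label o).edge ≠ e →
      conn M.blue M.yellow ≤ conn (collapse β (M.labelSet e)) M.yellow := by
  unfold IsValid
  rw [h.conn_yellow_eq hM ho]
  constructor
  · exact fun k e he _ => k e he
  · intro k e he
    by_cases heo : (M.label o).edge = e
    · rw [← heo, h.collapse_eq ho]
      exact hM _ (M.label o).edge_mem
    · exact k e he heo

/-- The vertex of `B` at the start of `a` can be pinched freely: the edges on both sides of it are
connected outside `B`, whatever faces are removed. -/
def IsFree (M : EmbeddedMap d n E) (B : M.BlueFace) (a : E) : Prop :=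
  ∀ e ∈ (latticeGraph d).edgeSet, (M.label a).edge ≠ e → M.outerConn B e (M.blue⁻¹ a) a

/-- The splitting could only separate `a` from `b`. Afterwards the edge before `a` is followed by
`b`, while freeness joins that edge to `a` outside `B`; so no connection is lost. -/
theorem IsPinched.isValid_swap_mul_iff (h : M.IsPinched B β) (hM : M.IsValid M.blue) {a b : E}
    (ha : a ∈ M.faceSet B) (hfree : M.IsFree B a) (hfix : β (M.blue⁻¹ a) = a)
    (hab : β.SameCycle a b) (hl : M.label a = M.label b) :
    M.IsValid (swap a b * β) ↔ M.IsValid β := by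
  have h' := h.swap_mul ha hab hl
  rw [h.isValid_iff hM ha, h'.isValid_iff hM ha]
  refine forall₃_congr fun e he hne => ?_
  have hb : b ∈ M.faceSet B := (mem_faceSet_congr (h.cycles_le hab)).2 ha
  have hB : ∀ x ∈ M.faceSet B, x ∉ M.labelSet e := fun x hx k =>
    hne ((label_edge_eq_of_mem ha hx).trans k)
  have hm := apply_mem_labelSet h.label_apply e
  have hm' := apply_mem_labelSet h'.label_apply e
  have heq : collapse (swap a b * β) (M.labelSet e) = swap a b * collapse β (M.labelSet e) := by
    ext x
    by_cases hx : x ∈ M.labelSet e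
    · rw [collapse_of_mem hm' hx, Perm.mul_apply, collapse_of_mem hm hx, swap_apply_of_ne_of_ne]
      · rintro rfl; exact hB _ ha hx
      · rintro rfl; exact hB _ hb hx
    · rw [collapse_of_notMem hm' hx, Perm.mul_apply, Perm.mul_apply, collapse_of_notMem hm hx]
  have hs : (collapse β (M.labelSet e)).SameCycle a b :=
    (sameCycle_congr_on (S := (M.labelSet e)ᶜ)
      (fun z hz => ⟨(collapse_of_notMem hm hz).symm, fun k => hz ((hm z).1 k)⟩) (hB a ha) hab).1
  have hrel : conn (collapse (swap a b * β) (M.labelSet e)) M.yellow a b := by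
    have h1 := h'.outerConn_le e (hfree e he hne)
    have h2 := conn_left (collapse (swap a b * β) (M.labelSet e)) M.yellow (M.blue⁻¹ a)
    rw [collapse_of_notMem hm' (hB _ (blue_inv_mem_faceSet.2 ha)), Perm.mul_apply, hfix,
      swap_apply_left] at h2
    exact Setoid.trans' _ (Setoid.symm' _ h1) h2
  have : conn (collapse β (M.labelSet e)) M.yellow =
      conn (collapse (swap a b * β) (M.labelSet e)) M.yellow := by
    rw [← glue_eq_self hrel, heq, conn, cycles_eq_glue hs, glue_sup]
  rw [this]

/-- If every corner is free, the connections made by `B` between consecutive edges are all available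
outside `B`, hence independent of how `B` is pinched. -/
theorem IsPinched.isValid_of_forall_isFree (h : M.IsPinched B β) (hM : M.IsValid M.blue) {o : E}
    (ho : o ∈ M.faceSet B) (hfree : ∀ a ∈ M.faceSet B, M.IsFree B a) : M.IsValid β := by
  rw [h.isValid_iff hM ho]
  intro e he hne
  refine (hM e he).trans (le_trans ?_ (h.outerConn_le e))
  refine conn_le_iff.2 ⟨fun x => ?_, conn_right _ _⟩
  have hm := apply_mem_labelSet M.label_blue e
  by_cases hx : x ∈ M.labelSet e
  · rw [collapse_of_mem hm hx]
  rw [collapse_of_notMem hm hx]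
  by_cases hxB : x ∈ M.faceSet B
  · have hbx := blue_mem_faceSet.2 hxB
    have := hfree _ hbx e he (label_edge_eq_of_mem hbx ho ▸ hne)
    rwa [show M.blue⁻¹ (M.blue x) = x from M.blue.symm_apply_apply x] at this
  · have hx' : x ∉ M.labelSet e ∪ M.faceSet B := fun k => k.elim hx hxB
    have := conn_left (collapse M.blue (M.labelSet e ∪ M.faceSet B)) M.yellow x
    rwa [collapse_of_notMem (M.outer_invariant B e) hx'] at this

end EmbeddedMap

end SurfaceSum

/-! ### Connections between corners outside the face -/

namespace SurfaceSum

theorem odd_sum_of_adj {d : ℕ} {u v : Fin d → ℤ} (h : (latticeGraph d).Adj u v) :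
    Odd (∑ i, (u i - v i)) := by
  have h1 : (2 : ℤ) ∣ ∑ i, (|u i - v i| - (u i - v i)) := by
    refine Finset.dvd_sum fun i _ => ?_
    rcases abs_choice (u i - v i) with h | h <;> rw [h]
    · simp
    · exact ⟨-(u i - v i), by ring⟩
  rw [Finset.sum_sub_distrib, show ∑ i, |u i - v i| = 1 from h] at h1
  obtain ⟨k, hk⟩ := h1
  exact ⟨-k, by linarith⟩

/-- The coordinate sum changes parity along each lattice edge, whereas three differences around a
triangle add up to zero. -/
theorem latticeGraph_triangle_free {d : ℕ} {u v w : Fin d → ℤ} (h1 : (latticeGraph d).Adj u v)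
    (h2 : (latticeGraph d).Adj v w) (h3 : (latticeGraph d).Adj w u) : False := by
  have h := ((odd_sum_of_adj h1).add_odd (odd_sum_of_adj h2)).add_odd (odd_sum_of_adj h3)
  rw [← Finset.sum_add_distrib, ← Finset.sum_add_distrib] at h
  simp at h

/-- Two lattice edges at the two ends of a third one are disjoint. -/
theorem disjoint_of_adj {d : ℕ} {x y z : Fin d → ℤ} {e e' : Sym2 (Fin d → ℤ)}
    (he : e ∈ (latticeGraph d).edgeSet) (he' : e' ∈ (latticeGraph d).edgeSet)
    (hxy : (latticeGraph d).Adj x y) (hx : x ∈ e) (hy : y ∈ e') (hne : e ≠ s(x, y))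
    (hne' : e' ≠ s(x, y)) (hz : z ∈ e) (hz' : z ∈ e') : False := by
  have hxz : x ≠ z := by
    rintro rfl
    exact hne' ((Sym2.mem_and_mem_iff hxy.ne).1 ⟨hz', hy⟩)
  have hyz : y ≠ z := by
    rintro rfl
    exact hne ((Sym2.mem_and_mem_iff hxy.ne).1 ⟨hx, hz⟩)
  rw [(Sym2.mem_and_mem_iff hxz).1 ⟨hx, hz⟩, SimpleGraph.mem_edgeSet] at he
  rw [(Sym2.mem_and_mem_iff hyz).1 ⟨hy, hz'⟩, SimpleGraph.mem_edgeSet] at he'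
  exact latticeGraph_triangle_free hxy he' he.symm

namespace EmbeddedMap

variable {d n : ℕ} {E : Type*} [Fintype E] [DecidableEq E]
variable {M : EmbeddedMap d n E} {B : M.BlueFace} {β : Perm E}

theorem label_snd_yellow_inv (M : EmbeddedMap d n E) (z : E) :
    (M.label (M.yellow⁻¹ z)).snd = (M.label z).fst := by
  rw [← M.label_yellow, show M.yellow (M.yellow⁻¹ z) = z from M.yellow.apply_symm_apply z]

theorem label_fst_blue (M : EmbeddedMap d n E) (z : E) :
    (M.label (M.blue z)).fst = (M.label z).snd := by
  rw [M.label_blue]; rfl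

theorem fst_mem_of_labelSet {e : Sym2 (Fin d → ℤ)} {x : E} (h : x ∈ M.labelSet e) :
    (M.label x).fst ∈ e := by
  rw [← mem_labelSet.1 h]; exact Sym2.mem_mk_left _ _

theorem snd_mem_of_labelSet {e : Sym2 (Fin d → ℤ)} {x : E} (h : x ∈ M.labelSet e) :
    (M.label x).snd ∈ e := by
  rw [← mem_labelSet.1 h]; exact Sym2.mem_mk_right _ _

/-- The vertices of a blue face of a non-separable map are distinct. -/
theorem eq_of_same_vertex (hp : PlanarPair M.blue M.yellow) (hM : M.IsValid M.blue) {u v : E}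
    (hu : u ∈ M.faceSet B) (hv : v ∈ M.faceSet B) (h : (M.blue * M.yellow⁻¹).SameCycle u v) :
    u = v := by
  by_contra hne
  have huv := sameCycle_of_mem hu hv
  refine hp.not_conn hne huv h ?_
  -- Removing the faces over the lattice edge of `B` leaves `u` and `v` connected, and hence so does
  -- merely cutting `B`, against planarity.
  have h1 := hM _ (M.label u).edge_mem (cycles_le_conn_left _ _ huv)
  refine (conn_le_iff.2 ⟨fun x => ?_, conn_right _ _⟩ :
    _ ≤ conn (swap u v * M.blue) M.yellow) h1
  have hm := apply_mem_labelSet M.label_blue (M.label u).edge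
  by_cases hx : x ∈ M.labelSet (M.label u).edge
  · rw [collapse_of_mem hm hx]
  · rw [collapse_of_notMem hm hx]
    have hxB : M.blue x ∉ M.faceSet B := fun k =>
      hx (label_edge_eq_of_mem (blue_mem_faceSet.1 k) hu)
    have := conn_left (swap u v * M.blue) M.yellow x
    rwa [Perm.mul_apply, swap_apply_of_ne_of_ne] at this <;> rintro k <;> rw [k] at hxB <;>
      contradiction

/-- Contracted faces touch only vertices over the end points of `e`; any other vertex is unaffected.
-/
theorem sameCycle_of_fst_notMem {e : Sym2 (Fin d → ℤ)} {u v : E} (hu : (M.label u).fst ∉ e)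
    (h : (collapse M.blue (M.labelSet e) * M.yellow⁻¹).SameCycle u v) :
    (M.blue * M.yellow⁻¹).SameCycle u v := by
  refine (sameCycle_congr_on (S := {z | (M.label z).fst ∉ e}) (fun z hz => ?_) hu h).1
  have hw : M.yellow⁻¹ z ∉ M.labelSet e := fun k => hz (by
    rw [← label_snd_yellow_inv]; exact snd_mem_of_labelSet k)
  rw [Perm.mul_apply, Perm.mul_apply,
    collapse_of_notMem (apply_mem_labelSet M.label_blue e) hw]
  refine ⟨rfl, ?_⟩
  rw [Set.mem_ofPred_eq, label_fst_blue, label_snd_yellow_inv]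
  exact hz

theorem collapse_fst_mem {e : Sym2 (Fin d → ℤ)} {z : E} (hz : (M.label z).fst ∈ e) :
    (M.label ((collapse M.blue (M.labelSet e) * M.yellow⁻¹) z)).fst ∈ e := by
  rw [Perm.mul_apply]
  by_cases hw : M.yellow⁻¹ z ∈ M.labelSet e
  · rw [collapse_of_mem (apply_mem_labelSet M.label_blue e) hw]
    exact fst_mem_of_labelSet hw
  · rw [collapse_of_notMem (apply_mem_labelSet M.label_blue e) hw, label_fst_blue,
      label_snd_yellow_inv]
    exact hz

theorem labelSet_union_invariant (M : EmbeddedMap d n E) (e e' : Sym2 (Fin d → ℤ)) (x : E) :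
    M.blue x ∈ M.labelSet e ∪ M.labelSet e' ↔ x ∈ M.labelSet e ∪ M.labelSet e' :=
  or_congr (apply_mem_labelSet M.label_blue e x) (apply_mem_labelSet M.label_blue e' x)

/-- Collapsing the faces sent to `e'` does not affect a vertex sent to an end point of an edge `e`
disjoint from `e'`. -/
theorem sameCycle_collapse_union {e e' : Sym2 (Fin d → ℤ)} {u v : E}
    (hdisj : ∀ z, z ∈ e → z ∈ e' → False) (hu : (M.label u).fst ∈ e) {g : Perm E}
    (hg : ∀ z, (M.label z).fst ∈ e →
      g z = (collapse M.blue (M.labelSet e ∪ M.labelSet e') * M.yellow⁻¹) z)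
    (h : (collapse M.blue (M.labelSet e) * M.yellow⁻¹).SameCycle u v) : g.SameCycle u v := by
  refine (sameCycle_congr_on (S := {z | (M.label z).fst ∈ e}) (fun z hz => ?_) hu h).1
  refine ⟨?_, collapse_fst_mem hz⟩
  rw [hg z hz, Perm.mul_apply, Perm.mul_apply]
  by_cases hw : M.yellow⁻¹ z ∈ M.labelSet e
  · rw [collapse_of_mem (apply_mem_labelSet M.label_blue e) hw,
      collapse_of_mem (M.labelSet_union_invariant e e') (Or.inl hw)]
  · have hw' : M.yellow⁻¹ z ∉ M.labelSet e ∪ M.labelSet e' := by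
      rintro (k | k)
      · exact hw k
      · refine hdisj _ hz ?_
        rw [← label_snd_yellow_inv]
        exact snd_mem_of_labelSet k
    rw [collapse_of_notMem (apply_mem_labelSet M.label_blue e) hw,
      collapse_of_notMem (M.labelSet_union_invariant e e') hw']

/-- The vertices `u` and `v` of `B` are connected outside `B` by a chain of blue faces sent to the
same lattice edge, different from that of `B`. -/
def IsOuterPair (M : EmbeddedMap d n E) (B : M.BlueFace) (u v : E) : Prop :=
  u ∈ M.faceSet B ∧ v ∈ M.faceSet B ∧ u ≠ v ∧ ∃ e ∈ (latticeGraph d).edgeSet,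
    (M.label u).edge ≠ e ∧ (collapse M.blue (M.labelSet e) * M.yellow⁻¹).SameCycle u v

theorem IsOuterPair.symm {u v : E} (h : M.IsOuterPair B u v) : M.IsOuterPair B v u := by
  obtain ⟨hu, hv, hne, e, he, hue, h⟩ := h
  exact ⟨hv, hu, hne.symm, e, he, label_edge_eq_of_mem hu hv ▸ hue, h.symm⟩

theorem fst_mem_of_outer (hp : PlanarPair M.blue M.yellow) (hM : M.IsValid M.blue)
    {e : Sym2 (Fin d → ℤ)} {u v : E} (hu : u ∈ M.faceSet B) (hv : v ∈ M.faceSet B) (hne : u ≠ v)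
    (h : (collapse M.blue (M.labelSet e) * M.yellow⁻¹).SameCycle u v) :
    (M.label u).fst ∈ e := by
  by_contra k
  exact hne (eq_of_same_vertex hp hM hu hv (sameCycle_of_fst_notMem k h))

/-- The lattice edge `e` contains the images of both corners. In opposite classes these are the two
ends of the lattice edge of `B`, which would then be `e`. -/
theorem IsOuterPair.label_eq (hp : PlanarPair M.blue M.yellow) (hM : M.IsValid M.blue) {u v : E}
    (h : M.IsOuterPair B u v) : M.label u = M.label v := by
  obtain ⟨hu, hv, hne, e, he, hue, h⟩ := h
  have h1 := fst_mem_of_outer hp hM hu hv hne h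
  have h2 := fst_mem_of_outer hp hM hv hu hne.symm h.symm
  rcases label_eq_or_symm_of_mem hu hv with hl | hl
  · exact hl.symm
  · rw [hl] at h2
    exact (hue ((Sym2.mem_and_mem_iff (M.label u).adj.ne).1 ⟨h1, h2⟩).symm).elim

theorem blue_face_sameCycle {f : Perm E}
    (hf : ∀ x ∈ M.faceSet B, f x = M.blue x) {u v : E} (hu : u ∈ M.faceSet B)
    (hv : v ∈ M.faceSet B) : f.SameCycle u v :=
  (sameCycle_congr_on (S := M.faceSet B) (fun z hz => ⟨(hf z hz).symm, blue_mem_faceSet.2 hz⟩) hu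
    (sameCycle_of_mem hu hv)).1

theorem swap_blue_face_sameCycle {f : Perm E}
    (hf : ∀ x ∈ M.faceSet B, f x = M.blue x) {u v x y : E} (hu : u ∈ M.faceSet B)
    (hv : v ∈ M.faceSet B) (hx : x ∈ M.faceSet B) (h : (swap u v * M.blue).SameCycle x y) :
    (swap u v * f).SameCycle x y := by
  refine (sameCycle_congr_on (S := M.faceSet B) (fun z hz => ?_) hx h).1
  refine ⟨by rw [Perm.mul_apply, Perm.mul_apply, hf z hz], ?_⟩
  rw [Perm.mul_apply]
  rcases eq_or_ne (M.blue z) u with k | k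
  · rwa [k, swap_apply_left]
  rcases eq_or_ne (M.blue z) v with k' | k'
  · rwa [k', swap_apply_right]
  · rw [swap_apply_of_ne_of_ne k k']; exact blue_mem_faceSet.2 hz

/-- Outer connections in opposite partite classes do not cross. -/
theorem IsOuterPair.not_cross (hp : PlanarPair M.blue M.yellow) (hM : M.IsValid M.blue)
    {u v a w : E} (h : M.IsOuterPair B u v) (h' : M.IsOuterPair B a w)
    (hl : M.label u ≠ M.label a) : (swap u v * M.blue).SameCycle a w := by
  obtain ⟨hu, hv, hne, e, he, hue, huv⟩ := h
  obtain ⟨ha, hw, hne', e', he', hae, haw⟩ := h'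
  have h1 := fst_mem_of_outer hp hM hu hv hne huv
  have h2 := fst_mem_of_outer hp hM ha hw hne' haw
  have hla := (label_eq_or_symm_of_mem hu ha).resolve_left hl.symm
  have hafst : (M.label a).fst = (M.label u).snd := by rw [hla]; rfl
  have huedge : s((M.label u).fst, (M.label a).fst) = (M.label u).edge := by rw [hafst]; rfl
  -- The edges `e` and `e'` start from opposite ends of the lattice edge of `B`; a common point
  -- would give a triangle.
  have hdisj : ∀ z, z ∈ e → z ∈ e' → False := by
    intro z hz hz'
    refine disjoint_of_adj he he' (x := (M.label u).fst) (y := (M.label a).fst) ?_ h1 h2 ?_ ?_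
      hz hz'
    · rw [hafst]; exact (M.label u).adj
    · rw [huedge]; exact hue.symm
    · rw [huedge, label_edge_eq_of_mem hu ha]; exact hae.symm
  -- Both families of faces are contracted. By disjointness each contraction leaves the vertices
  -- concerned by the other alone, so `u, v` share a vertex and so do `a, w`.
  set c := collapse M.blue (M.labelSet e ∪ M.labelSet e') with hc
  have hcp : PlanarPair c M.yellow := hp.collapse (M.labelSet_union_invariant e e')
  have hcB : ∀ x ∈ M.faceSet B, c x = M.blue x := by
    intro x hx
    refine collapse_of_notMem (M.labelSet_union_invariant e e') ?_
    rintro (k | k)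
    · exact hue ((label_edge_eq_of_mem hu hx).trans k)
    · exact hae ((label_edge_eq_of_mem ha hx).trans k)
  have huv' : (c * M.yellow⁻¹).SameCycle u v :=
    sameCycle_collapse_union hdisj h1 (fun _ _ => rfl) huv
  have hnot := hcp.not_conn hne (blue_face_sameCycle hcB hu hv) huv'
  -- Cutting along `u v` alters only a vertex over `e`, so `a` and `w` stay together and must lie on
  -- one side.
  have haw' : ((swap u v * c) * M.yellow⁻¹).SameCycle a w := by
    refine sameCycle_collapse_union (fun z hz hz' => hdisj z hz' hz) h2 (fun z hz => ?_) haw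
    rw [Set.union_comm, ← hc, mul_assoc, Perm.mul_apply]
    have hz' : (M.label ((c * M.yellow⁻¹) z)).fst ∈ e' := by
      have := (sameCycle_congr_on (f := collapse M.blue (M.labelSet e') * M.yellow⁻¹)
        (g := collapse M.blue (M.labelSet e') * M.yellow⁻¹) (S := {z | (M.label z).fst ∈ e'})
        (fun z hz => ⟨rfl, collapse_fst_mem hz⟩) hz (sameCycle_apply_self _ z)).2
      have heq : (collapse M.blue (M.labelSet e') * M.yellow⁻¹) z = (c * M.yellow⁻¹) z := by
        rw [Perm.mul_apply, Perm.mul_apply, hc]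
        by_cases hw : M.yellow⁻¹ z ∈ M.labelSet e'
        · rw [collapse_of_mem (apply_mem_labelSet M.label_blue e') hw,
            collapse_of_mem (M.labelSet_union_invariant e e') (Or.inr hw)]
        · have hw' : M.yellow⁻¹ z ∉ M.labelSet e ∪ M.labelSet e' := by
            rintro (k | k)
            · refine hdisj _ ?_ hz
              rw [← label_snd_yellow_inv]
              exact snd_mem_of_labelSet k
            · exact hw k
          rw [collapse_of_notMem (apply_mem_labelSet M.label_blue e') hw,
            collapse_of_notMem (M.labelSet_union_invariant e e') hw']
      rw [← heq]
      exact this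
    have hv1 := fst_mem_of_outer hp hM hv hu hne.symm huv.symm
    apply swap_apply_of_ne_of_ne <;> intro k <;> rw [k] at hz'
    · exact hdisj _ h1 hz'
    · exact hdisj _ hv1 hz'
  have hcon : conn (swap u v * c) M.yellow a w := cycles_mul_inv_le_conn _ _ haw'
  have hsame := sameCycle_of_mem hu hv
  have h3 := sameCycle_swap_mul_or hsame (sameCycle_of_mem hu ha)
  have h4 := sameCycle_swap_mul_or hsame (sameCycle_of_mem hu hw)
  have hle : ∀ {x y}, x ∈ M.faceSet B → (swap u v * M.blue).SameCycle x y →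
      conn (swap u v * c) M.yellow x y := fun hx k =>
    cycles_le_conn_left _ _ (swap_blue_face_sameCycle hcB hu hv hx k)
  rcases h3 with h3 | h3 <;> rcases h4 with h4 | h4
  · exact h3.trans h4.symm
  · exact (hnot (Setoid.trans' _ (Setoid.symm' _ (hle ha h3)) (Setoid.trans' _ hcon
      (hle hw h4)))).elim
  · exact (hnot (Setoid.trans' _ (Setoid.symm' _ (hle hw h4)) (Setoid.trans' _
      (Setoid.symm' _ hcon) (hle ha h3)))).elim
  · exact h3.trans h4.symm

/-- Identifying two vertices that are connected outside `B` makes the map separable. -/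
theorem IsOuterPair.not_isValid (hp : PlanarPair M.blue M.yellow) (hM : M.IsValid M.blue)
    {u v : E} (h : M.IsOuterPair B u v) (hβ : M.IsPinched B β)
    (hθ : (β * M.blue⁻¹).SameCycle u v) : ¬ M.IsValid β := by
  obtain ⟨hu, hv, hne, e, he, hue, huv⟩ := h
  intro hval
  have hm := apply_mem_labelSet M.label_blue e
  have hmβ := apply_mem_labelSet hβ.label_apply e
  have hB : ∀ x ∈ M.faceSet B, x ∉ M.labelSet e := fun x hx k =>
    hue ((label_edge_eq_of_mem hu hx).trans k)
  have hcB : ∀ x ∈ M.faceSet B, collapse M.blue (M.labelSet e) x = M.blue x := fun x hx =>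
    collapse_of_notMem hm (hB x hx)
  -- After contraction `u` and `v` share a vertex, so cutting `B` there disconnects them. As `β`
  -- respects the two sides of the cut, validity of `β` would keep them connected.
  refine (hp.collapse hm).not_conn hne (blue_face_sameCycle hcB hu hv) huv ?_
  have h1 := (hβ.isValid_iff hM hu).1 hval e he hue
    (cycles_le_conn_left _ _ (sameCycle_of_mem hu hv))
  refine (conn_le_iff.2 ⟨fun x => ?_, conn_right _ _⟩ :
    _ ≤ conn (swap u v * collapse M.blue (M.labelSet e)) M.yellow) h1
  by_cases hx : x ∈ M.labelSet e
  · rw [collapse_of_mem hmβ hx]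
  rw [collapse_of_notMem hmβ hx]
  by_cases hxB : x ∈ M.faceSet B
  · exact cycles_le_conn_left _ _
      (swap_blue_face_sameCycle hcB hu hv hxB (hβ.apply_side hne hθ hxB))
  · have hbx : M.blue x ∉ M.faceSet B := fun k => hxB (blue_mem_faceSet.1 k)
    have := conn_left (swap u v * collapse M.blue (M.labelSet e)) M.yellow x
    rw [Perm.mul_apply, collapse_of_notMem hm hx, swap_apply_of_ne_of_ne] at this
    · rwa [hβ.off x hxB]
    · rintro k; rw [k] at hbx; contradiction
    · rintro k; rw [k] at hbx; contradiction

/-- A vertex that is not connected outside `B` to other vertices of `B` can be pinched freely. -/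
theorem isFree_of_forall_not_isOuterPair {a : E} (ha : a ∈ M.faceSet B)
    (h : ∀ v, ¬ M.IsOuterPair B a v) : M.IsFree B a := by
  intro e he hae
  have hm := apply_mem_labelSet M.label_blue e
  have hB : ∀ x ∈ M.faceSet B, x ∉ M.labelSet e := fun x hx k =>
    hae ((label_edge_eq_of_mem ha hx).trans k)
  set f := collapse M.blue (M.labelSet e) * M.yellow⁻¹ with hf
  have hstep : ∀ z w, collapse M.blue (M.labelSet e) w = z → f⁻¹ z = M.yellow w := by
    intro z w hw
    rw [Perm.inv_eq_iff_eq, hf, Perm.mul_apply,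
      show M.yellow⁻¹ (M.yellow w) = w from M.yellow.symm_apply_apply w, hw]
  -- The corners around the vertex of `a` in the contracted map are visited in reverse. None before
  -- the return to `a` is in `B`, so each step uses only faces kept in `outerConn`; the full turn
  -- links the edge before `a` to `a`.
  have key : ∀ i, i < Function.minimalPeriod ⇑(f⁻¹) a →
      M.outerConn B e (M.blue⁻¹ a) ((f⁻¹ ^ (i + 1)) a) := by
    intro i hi
    induction i with
    | zero =>
      rw [zero_add, pow_one, hstep a (M.blue⁻¹ a)]
      · exact conn_right _ _ _
      · rw [collapse_of_notMem hm (hB _ (blue_inv_mem_faceSet.2 ha))]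
        exact M.blue.apply_symm_apply a
    | succ i ih =>
      refine Setoid.trans' _ (ih (by omega)) ?_
      set z := (f⁻¹ ^ (i + 1)) a with hz
      have hza : z ≠ a := by
        intro k
        have := pow_inj_of_lt_period (j := 0) hi (by omega) (hz.symm.trans k)
        omega
      have hzB : z ∉ M.faceSet B := by
        intro k
        refine h z ⟨ha, k, hza.symm, e, he, hae, ?_⟩
        rw [← hf, ← Perm.sameCycle_inv]
        exact ⟨(i + 1 : ℕ), by rw [zpow_natCast]⟩
      obtain ⟨w, hw⟩ := (collapse M.blue (M.labelSet e)).surjective z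
      rw [pow_succ', Perm.mul_apply, ← hz, hstep z w hw]
      have hw' : collapse M.blue (M.labelSet e ∪ M.faceSet B) w = z := by
        by_cases hwe : w ∈ M.labelSet e
        · rw [collapse_of_mem (M.outer_invariant B e) (Or.inl hwe), ← hw, collapse_of_mem hm hwe]
        · rw [collapse_of_notMem hm hwe] at hw
          rw [collapse_of_notMem (M.outer_invariant B e), hw]
          rintro (k | k)
          · exact hwe k
          · rw [← hw, blue_mem_faceSet] at hzB
            exact hzB k
      have h1 := conn_left (collapse M.blue (M.labelSet e ∪ M.faceSet B)) M.yellow w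
      rw [hw'] at h1
      exact Setoid.trans' _ (Setoid.symm' _ h1) (conn_right _ _ w)
  have hpos := period_pos f⁻¹ a
  have := key (Function.minimalPeriod ⇑(f⁻¹) a - 1) (by omega)
  rwa [Nat.sub_add_cancel hpos, pow_period] at this

end EmbeddedMap

end SurfaceSum

namespace SurfaceSum

/-! ### Weights -/

section Weights

variable {E : Type*} [Fintype E]

/-- The weight of a collection of blue faces given as the cycles of a permutation. -/
noncomputable def permWeight (f : Perm E) : ℤ := ∏ F : Orbits f, signedCatalan (F.size / 2)

open Classical in
/-- The elements of a cycle. -/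
noncomputable def orbitFinset {f : Perm E} (F : Orbits f) : Finset E :=
  Finset.univ.filter fun x => Orbits.mk f x = F

/-- The cycle of `x` as a finite set. -/
noncomputable def cycleFinset (f : Perm E) (x : E) : Finset E := orbitFinset (Orbits.mk f x)

theorem mem_orbitFinset {f : Perm E} {F : Orbits f} {x : E} :
    x ∈ orbitFinset F ↔ Orbits.mk f x = F := by
  simp [orbitFinset]

theorem mem_cycleFinset {f : Perm E} {x y : E} : y ∈ cycleFinset f x ↔ f.SameCycle x y := by
  rw [cycleFinset, mem_orbitFinset, Orbits.mk_eq_iff, Perm.sameCycle_comm]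

theorem card_orbitFinset {f : Perm E} (F : Orbits f) : (orbitFinset F).card = F.size := by
  classical
  rw [Orbits.size, Nat.card_eq_fintype_card, Fintype.card_subtype, orbitFinset]

theorem orbitFinset_injective (f : Perm E) :
    Function.Injective (orbitFinset : Orbits f → Finset E) := by
  intro F G h
  obtain ⟨x, rfl⟩ := Quotient.exists_rep F
  have : x ∈ orbitFinset G := h ▸ mem_orbitFinset.2 rfl
  exact mem_orbitFinset.1 this

theorem card_cycleFinset (f : Perm E) (x : E) :
    (cycleFinset f x).card = Function.minimalPeriod f x := by
  classical
  have : cycleFinset f x = (Finset.range (Function.minimalPeriod f x)).image fun i => (f ^ i) x := by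
    ext y
    rw [mem_cycleFinset, sameCycle_iff_exists_lt_period]
    simp
  rw [this, Finset.card_image_of_injOn, Finset.card_range]
  intro i hi j hj h
  exact pow_inj_of_lt_period (by simpa using hi) (by simpa using hj) h

theorem cycleFinset_congr {f g : Perm E} {S : Set E} (hS : ∀ x ∈ S, f x = g x ∧ f x ∈ S) {x : E}
    (hx : x ∈ S) : cycleFinset f x = cycleFinset g x := by
  ext y
  rw [mem_cycleFinset, mem_cycleFinset]
  exact ⟨fun h => (sameCycle_congr_on hS hx h).1, fun h => (sameCycle_congr_on
    (fun z hz => ⟨(hS z hz).1.symm, (hS z hz).1 ▸ (hS z hz).2⟩) hx h).1⟩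

variable [DecidableEq E]

theorem prod_orbits (f : Perm E) (T : Finset (Orbits f)) (W : ℕ → ℤ) :
    ∏ F ∈ T, W F.size = ∏ s ∈ T.image orbitFinset, W s.card := by
  rw [Finset.prod_image (orbitFinset_injective f).injOn]
  simp only [card_orbitFinset]

theorem image_orbitFinset_univ (f : Perm E) :
    (Finset.univ : Finset (Orbits f)).image orbitFinset = Finset.univ.image (cycleFinset f) := by
  ext s
  simp only [Finset.mem_image, Finset.mem_univ, true_and, cycleFinset]
  constructor
  · rintro ⟨F, rfl⟩
    obtain ⟨x, rfl⟩ := Quotient.exists_rep F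
    exact ⟨x, rfl⟩
  · rintro ⟨x, rfl⟩
    exact ⟨_, rfl⟩

/-- The weight of a permutation, split along an invariant set. -/
theorem permWeight_split {f : Perm E} {S : Finset E} (hS : ∀ x ∈ S, f x ∈ S) :
    permWeight f = (∏ s ∈ S.image (cycleFinset f), signedCatalan (s.card / 2)) *
      ∏ s ∈ Sᶜ.image (cycleFinset f), signedCatalan (s.card / 2) := by
  rw [permWeight, prod_orbits f Finset.univ fun k => signedCatalan (k / 2),
    image_orbitFinset_univ, ← Finset.prod_union, ← Finset.image_union, Finset.union_compl]
  rw [Finset.disjoint_left]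
  intro s h1 h2
  obtain ⟨x, hx, rfl⟩ := Finset.mem_image.1 h1
  obtain ⟨y, hy, e⟩ := Finset.mem_image.1 h2
  have hxy : f.SameCycle x y := by
    rw [← mem_cycleFinset, ← e, mem_cycleFinset]
  have := (sameCycle_congr_on (f := f) (g := f) (S := {z | z ∈ S})
    (fun z hz => ⟨rfl, hS z hz⟩) hx hxy).2
  exact Finset.mem_compl.1 hy this

/-- The effect on the weight of splitting the cycle of `a`. -/
theorem permWeight_swap_mul (f : Perm E) (a : E) : ∃ R : ℤ,
    permWeight f = signedCatalan (Function.minimalPeriod f a / 2) * R ∧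
    ∀ j, 0 < j → j < Function.minimalPeriod f a → permWeight (swap a ((f ^ j) a) * f) =
      signedCatalan (j / 2) * signedCatalan ((Function.minimalPeriod f a - j) / 2) * R := by
  have hC : ∀ x, x ∈ cycleFinset f a ↔ f x ∈ cycleFinset f a := by
    intro x
    rw [mem_cycleFinset, mem_cycleFinset]
    exact ⟨fun h => h.trans (sameCycle_apply_self f x),
      fun h => h.trans (sameCycle_apply_self f x).symm⟩
  -- `R` collects the cycles other than that of `a`, which the splitting does not touch.
  refine ⟨∏ s ∈ (cycleFinset f a)ᶜ.image (cycleFinset f), signedCatalan (s.card / 2), ?_, ?_⟩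
  · rw [permWeight_split (f := f) (S := cycleFinset f a) fun x hx => (hC x).1 hx]
    congr 1
    have : (cycleFinset f a).image (cycleFinset f) = {cycleFinset f a} := by
      ext s
      simp only [Finset.mem_image, Finset.mem_singleton]
      constructor
      · rintro ⟨x, hx, rfl⟩
        rw [cycleFinset, cycleFinset, Orbits.mk_eq_iff.2 (mem_cycleFinset.1 hx)]
      · rintro rfl
        exact ⟨a, mem_cycleFinset.2 (Perm.SameCycle.refl _ _), rfl⟩
    rw [this, Finset.prod_singleton, card_cycleFinset]
  · intro j hj hjN
    set b := (f ^ j) a with hb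
    set g := swap a b * f with hg
    have hab : f.SameCycle a b := ⟨j, by simp [hb]⟩
    have hne : a ≠ b := by
      intro h
      have := pow_inj_of_lt_period (i := 0) (by omega) hjN (show (f ^ 0) a = (f ^ j) a from h)
      omega
    have haC : a ∈ cycleFinset f a := mem_cycleFinset.2 (Perm.SameCycle.refl _ _)
    have hbC : b ∈ cycleFinset f a := mem_cycleFinset.2 hab
    have hgS : ∀ x ∈ cycleFinset f a, g x ∈ cycleFinset f a := by
      intro x hx
      rw [hg, Perm.mul_apply]
      rcases eq_or_ne (f x) a with k | k
      · rwa [k, swap_apply_left]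
      rcases eq_or_ne (f x) b with k' | k'
      · rwa [k', swap_apply_right]
      · rw [swap_apply_of_ne_of_ne k k']; exact (hC x).1 hx
    have hns : ¬ g.SameCycle a b := not_sameCycle_swap_mul hne hab
    have hcard : (cycleFinset g a).card = j := by
      have : cycleFinset g a = (Finset.range j).image fun i => (f ^ i) a := by
        ext y
        rw [mem_cycleFinset, hg, hb, sameCycle_swap_mul_pow_iff hjN hj]
        simp
      rw [this, Finset.card_image_of_injOn, Finset.card_range]
      intro i hi k hk h
      have hi' : i < j := by simpa using hi
      have hk' : k < j := by simpa using hk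
      exact pow_inj_of_lt_period (by omega) (by omega) h
    have hor : ∀ x ∈ cycleFinset f a, g.SameCycle x a ∨ g.SameCycle x b := fun x hx =>
      sameCycle_swap_mul_or hab (mem_cycleFinset.1 hx)
    have hunion : cycleFinset g a ∪ cycleFinset g b = cycleFinset f a := by
      ext x
      rw [Finset.mem_union, mem_cycleFinset, mem_cycleFinset]
      constructor
      · have hinv := fun z (hz : z ∈ (cycleFinset f a : Set E)) =>
          (⟨rfl, hgS z hz⟩ : g z = g z ∧ g z ∈ (cycleFinset f a : Set E))
        rintro (h | h)
        · exact (sameCycle_congr_on (f := g) (g := g) hinv haC h).2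
        · exact (sameCycle_congr_on (f := g) (g := g) hinv hbC h).2
      · exact fun h => (hor x h).imp Perm.SameCycle.symm Perm.SameCycle.symm
    have hdisj : Disjoint (cycleFinset g a) (cycleFinset g b) := by
      rw [Finset.disjoint_left]
      intro x h1 h2
      exact hns ((mem_cycleFinset.1 h1).trans (mem_cycleFinset.1 h2).symm)
    have hcard' : (cycleFinset g b).card = Function.minimalPeriod f a - j := by
      rw [← card_cycleFinset, ← hunion, Finset.card_union_of_disjoint hdisj, hcard]
      omega
    have himage : (cycleFinset f a).image (cycleFinset g) = {cycleFinset g a, cycleFinset g b} := by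
      ext s
      simp only [Finset.mem_image, Finset.mem_insert, Finset.mem_singleton]
      constructor
      · rintro ⟨x, hx, rfl⟩
        refine (hor x hx).imp (fun k => ?_) fun k => ?_ <;>
        rw [cycleFinset, cycleFinset, Orbits.mk_eq_iff.2 k]
      · rintro (rfl | rfl)
        · exact ⟨a, haC, rfl⟩
        · exact ⟨b, hbC, rfl⟩
    have hrest : (cycleFinset f a)ᶜ.image (cycleFinset g) =
        (cycleFinset f a)ᶜ.image (cycleFinset f) := by
      refine Finset.image_congr fun x hx => ?_
      refine cycleFinset_congr (S := ((cycleFinset f a)ᶜ : Finset E)) (fun z hz => ?_) hx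
      have hz' : f z ∉ cycleFinset f a := fun k =>
        Finset.mem_compl.1 (Finset.mem_coe.1 hz) ((hC z).2 k)
      have hgz : g z = f z := by
        rw [hg, Perm.mul_apply, swap_apply_of_ne_of_ne] <;> rintro k <;> rw [k] at hz' <;>
          contradiction
      rw [hgz]
      exact ⟨rfl, Finset.mem_coe.2 (Finset.mem_compl.2 hz')⟩
    have hcne : cycleFinset g a ≠ cycleFinset g b := fun h => hns (by
      rw [← mem_cycleFinset, h, mem_cycleFinset])
    rw [permWeight_split hgS, himage, hrest, Finset.prod_pair hcne, hcard, hcard']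

theorem signedCatalan_one : signedCatalan 1 = 1 := by
  simp [signedCatalan]

/-- This is the Catalan convolution: all products carry the same sign, opposite to that of the
leading term. -/
theorem signedCatalan_recursion {m : ℕ} (hm : 2 ≤ m) :
    signedCatalan m + ∑ i ∈ Finset.range (m - 1), signedCatalan (i + 1) *
      signedCatalan (m - (i + 1)) = 0 := by
  obtain ⟨k, rfl⟩ := Nat.exists_eq_add_of_le' hm
  rw [show k + 2 - 1 = k + 1 by omega]
  have h : ∀ i ∈ Finset.range (k + 1), signedCatalan (i + 1) * signedCatalan (k + 2 - (i + 1)) =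
      (-1) ^ k * ((catalan i * catalan (k - i) : ℕ) : ℤ) := by
    intro i hi
    have hi' : i ≤ k := by simpa [Nat.lt_succ_iff] using hi
    obtain ⟨l, rfl⟩ := Nat.exists_eq_add_of_le hi'
    rw [signedCatalan, signedCatalan, Nat.add_sub_cancel,
      show i + l + 2 - (i + 1) - 1 = l by omega, Nat.add_sub_cancel_left, pow_add]
    push_cast
    ring
  rw [Finset.sum_congr rfl h, ← Finset.mul_sum, ← Nat.cast_sum, signedCatalan,
    show k + 2 - 1 = k + 1 by omega, catalan_succ, Finset.sum_range fun i =>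
      catalan i * catalan (k - i), pow_succ]
  ring

/-- The local cancellation: the total weight of all the ways of splitting a face of degree at least
four along one of its vertices vanishes. -/
theorem sum_permWeight_swap_mul {f : Perm E} {a : E} {m : ℕ}
    (hN : Function.minimalPeriod f a = 2 * m) (hm : 2 ≤ m) :
    ∑ i ∈ Finset.range m, permWeight (swap a ((f ^ (2 * i)) a) * f) = 0 := by
  obtain ⟨R, h0, hR⟩ := permWeight_swap_mul f a
  obtain ⟨k, rfl⟩ : ∃ k, m = k + 1 := ⟨m - 1, by omega⟩
  have h1 : ∀ i ∈ Finset.range k, permWeight (swap a ((f ^ (2 * (i + 1))) a) * f) =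
      signedCatalan (i + 1) * signedCatalan (k + 1 - (i + 1)) * R := by
    intro i hi
    have hi' : i < k := by simpa using hi
    rw [hR _ (by omega) (by omega), hN, show 2 * (i + 1) / 2 = i + 1 by omega,
      show (2 * (k + 1) - 2 * (i + 1)) / 2 = k + 1 - (i + 1) by omega]
  -- The term `i = 0` is the unsplit face, which supplies the leading term of the recursion.
  rw [Finset.sum_range_succ', Finset.sum_congr rfl h1, mul_zero, pow_zero, Perm.one_apply,
    swap_self, ← Perm.one_def, one_mul, h0, hN, show 2 * (k + 1) / 2 = k + 1 by omega,
    ← Finset.sum_mul, ← add_mul, add_comm]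
  have := signedCatalan_recursion hm
  rw [Nat.add_sub_cancel] at this
  rw [this, zero_mul]

end Weights

end SurfaceSum

namespace SurfaceSum

namespace EmbeddedMap

variable {d n : ℕ} {E : Type*} [Fintype E] [DecidableEq E]
variable {M : EmbeddedMap d n E} {B : M.BlueFace} {β : Perm E}

/-! ### Planar maps and their isomorphisms -/

theorem conn_of_mem_closure {g : Perm E} (hg : g ∈ Subgroup.closure {M.blue, M.yellow}) :
    ∀ x, conn M.blue M.yellow x (g x) := by
  induction hg using Subgroup.closure_induction with
  | mem g hg =>
    rcases hg with rfl | rfl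
    · exact conn_left _ _
    · exact conn_right _ _
  | one => exact fun x => Setoid.refl' _ x
  | mul g h _ _ ihg ihh => exact fun x => Setoid.trans' _ (ihh x) (ihg (h x))
  | inv g _ ih =>
    intro x
    have := ih (g⁻¹ x)
    rw [show g (g⁻¹ x) = x from g.apply_symm_apply x] at this
    exact Setoid.symm' _ this

theorem exists_mem_closure_of_conn {x y : E} (h : conn M.blue M.yellow x y) :
    ∃ g ∈ Subgroup.closure {M.blue, M.yellow}, g x = y := by
  have hle : conn M.blue M.yellow ≤
      MulAction.orbitRel (Subgroup.closure {M.blue, M.yellow}) E := by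
    refine conn_le_iff.2 ⟨fun z => ?_, fun z => ?_⟩
    · exact (MulAction.orbitRel _ E).symm (MulAction.orbitRel_apply.2
        ⟨⟨M.blue, Subgroup.subset_closure (by simp)⟩, rfl⟩)
    · exact (MulAction.orbitRel _ E).symm (MulAction.orbitRel_apply.2
        ⟨⟨M.yellow, Subgroup.subset_closure (by simp)⟩, rfl⟩)
  obtain ⟨g, hg⟩ := MulAction.orbitRel_apply.1 ((MulAction.orbitRel _ E).symm (hle h))
  exact ⟨g.1, g.2, hg⟩

/-- The roots represent the components exactly once, so there are `n` of them. -/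
theorem IsPlanar.planarPair (h : M.IsPlanar) : PlanarPair M.blue M.yellow := by
  have hn : classCount (conn M.blue M.yellow) = n := by
    refine (Nat.card_congr (Equiv.ofBijective
      (fun i => Quotient.mk (conn M.blue M.yellow) (M.root i))
      ⟨fun i j hij => ?_, fun q => ?_⟩).symm).trans (Nat.card_fin n)
    · obtain ⟨g, hg, e⟩ := exists_mem_closure_of_conn (Quotient.exact hij)
      exact (h.component (M.root j)).unique ⟨g, hg, e⟩ ⟨1, Subgroup.one_mem _, rfl⟩
    · induction q using Quotient.inductionOn with | _ x
      obtain ⟨i, ⟨g, hg, rfl⟩, -⟩ := h.component x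
      exact ⟨i, Quotient.sound (conn_of_mem_closure hg _)⟩
  have he := h.euler
  unfold PlanarPair
  rw [hn, Nat.card_eq_fintype_card]
  simp only [← Nat.card_eq_fintype_card (α := M.Vertex),
    ← Nat.card_eq_fintype_card (α := M.BlueFace),
    ← Nat.card_eq_fintype_card (α := M.YellowFace)] at he
  rw [← he, ← add_assoc]
  rfl

/-- Isomorphic maps obtained by pinchings of the same face are equal. -/
theorem blue_eq_of_iso (hpl : M.IsPlanar) (hM : M.IsValid M.blue) {P Q : M.FeasibleCollection B}
    (h : Iso (M.perform P) (M.perform Q)) : (M.perform P).blue = (M.perform Q).blue := by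
  obtain ⟨σ, h1, h2, -, h4⟩ := h
  obtain ⟨o, rfl⟩ := Quotient.exists_rep B
  have ho : o ∈ M.faceSet (Orbits.mk M.blue o) := rfl
  have hP := isPinched_perform P
  have hQ := isPinched_perform Q
  -- The fixed points of `σ` are propagated from the roots through yellow faces and through blue
  -- faces other than those over the lattice edge of `B`; by non-separability these connections
  -- reach every edge.
  have hfix : ∀ x, σ x = x := by
    intro x
    obtain ⟨i, ⟨g, hg, e⟩, -⟩ := hpl.component x
    have hx := hM _ (M.label o).edge_mem (e ▸ conn_of_mem_closure hg (M.root i))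
    have hle : conn (collapse M.blue (M.labelSet (M.label o).edge)) M.yellow ≤
        Setoid.ker fun z => (σ z = z : Prop) := by
      have hm := apply_mem_labelSet M.label_blue (M.label o).edge
      refine conn_le_iff.2 ⟨fun z => ?_, fun z => ?_⟩
      · by_cases hz : z ∈ M.labelSet (M.label o).edge
        · rw [collapse_of_mem hm hz]
        rw [collapse_of_notMem hm hz, Setoid.ker_def, eq_iff_iff]
        have hzB : z ∉ M.faceSet (Orbits.mk M.blue o) := fun k =>
          hz (label_edge_eq_of_mem k ho)
        have e1 := h1 z
        rw [hP.off z hzB] at e1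
        rw [e1, ← hQ.off z hzB, (M.perform Q).blue.apply_eq_iff_eq]
      · rw [Setoid.ker_def, eq_iff_iff]
        have e2 : σ (M.yellow z) = M.yellow (σ z) := h2 z
        rw [e2, M.yellow.apply_eq_iff_eq]
    have hroot : σ (M.root i) = M.root i := h4 i
    have := hle hx
    rw [Setoid.ker_def, eq_iff_iff] at this
    exact this.1 hroot
  ext x
  have := h1 x
  rwa [hfix, hfix] at this

/-! ### The sum over valid pinched maps -/

open Classical in
/-- The blue faces of the valid maps obtained by pinchings of `B`. -/
noncomputable def validPerms (M : EmbeddedMap d n E) (B : M.BlueFace) : Finset (Perm E) :=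
  Finset.univ.filter fun β => M.IsPinched B β ∧ M.IsValid β

theorem mem_validPerms : β ∈ M.validPerms B ↔ M.IsPinched B β ∧ M.IsValid β := by
  simp [validPerms]

theorem sum_validMaps (hpl : M.IsPlanar) (hM : M.IsValid M.blue) :
    ∑ m ∈ (M.validMaps_finite B).toFinset, m.weight = ∑ β ∈ M.validPerms B, permWeight β := by
  have hex : ∀ β ∈ M.validPerms B, ∃ P : M.FeasibleCollection B, (M.perform P).blue = β :=
    fun β hβ => (mem_validPerms.1 hβ).1.exists_perform
  choose P hP using hex
  symm
  refine Finset.sum_bij (fun β hβ => (Quotient.mk _ (M.perform (P β hβ)) : MapClass d n E))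
    (fun β hβ => ?_) (fun β hβ β' hβ' h => ?_) (fun m hm => ?_) (fun β hβ => ?_)
  · refine (Set.Finite.mem_toFinset _).2 ⟨P β hβ, (perform_nonSeparable_iff _).2 ?_, rfl⟩
    rw [hP]
    exact (mem_validPerms.1 hβ).2
  · rw [← hP β hβ, ← hP β' hβ']
    exact blue_eq_of_iso hpl hM (Quotient.exact h)
  · rw [Set.Finite.mem_toFinset] at hm
    obtain ⟨Q, hQ, rfl⟩ := hm
    refine ⟨(M.perform Q).blue,
      mem_validPerms.2 ⟨isPinched_perform Q, (perform_nonSeparable_iff _).1 hQ⟩, ?_⟩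
    refine Quotient.sound ⟨1, fun x => ?_, fun x => rfl, fun x => rfl, fun i => rfl⟩
    rw [hP]
    rfl
  · change _ = permWeight (M.perform (P β hβ)).blue
    rw [hP]

/-! ### Digons and cancellation at free corners -/

theorem symm_ne_label (M : EmbeddedMap d n E) (x : E) : (M.label x).symm ≠ M.label x :=
  SimpleGraph.Dart.symm_ne _

theorem label_pow {f : Perm E} (h : ∀ x, M.label (f x) = (M.label x).symm) (a : E) (i : ℕ) :
    M.label ((f ^ i) a) = if Even i then M.label a else (M.label a).symm := by
  induction i with
  | zero => simp
  | succ i ih =>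
    rw [pow_succ', Perm.mul_apply, h, ih]
    by_cases hi : Even i
    · simp [hi, Nat.even_add_one]
    · simp [hi, Nat.even_add_one]

theorem even_of_label_pow {f : Perm E} (h : ∀ x, M.label (f x) = (M.label x).symm) {a : E} {i : ℕ}
    (hi : M.label ((f ^ i) a) = M.label a) : Even i := by
  rw [label_pow h] at hi
  by_contra k
  rw [if_neg k] at hi
  exact M.symm_ne_label a hi

theorem label_blue_inv (M : EmbeddedMap d n E) (a : E) :
    M.label (M.blue⁻¹ a) = (M.label a).symm := by
  conv_rhs => rw [← show M.blue (M.blue⁻¹ a) = a from M.blue.apply_symm_apply a, M.label_blue]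
  rw [SimpleGraph.Dart.symm_symm]

/-- The vertex at the start of `a` is the corner of a face of degree two. -/
def IsDigon (M : EmbeddedMap d n E) (β : Perm E) (a : E) : Prop :=
  β a = M.blue⁻¹ a ∧ β (M.blue⁻¹ a) = a

theorem IsPinched.label_apply_blue_inv (h : M.IsPinched B β) (a : E) :
    M.label (β (M.blue⁻¹ a)) = M.label a := by
  rw [h.label_apply, label_blue_inv, SimpleGraph.Dart.symm_symm]

theorem IsDigon.swap_mul {a c a' : E}
    (hc : M.label c = M.label a) (ha' : M.label a' = M.label a) (hne : a' ≠ a) (hne' : a' ≠ c)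
    (hd : M.IsDigon β a') : M.IsDigon (swap a c * β) a' := by
  constructor
  · rw [Perm.mul_apply, hd.1, swap_apply_of_ne_of_ne]
    · intro k
      have := M.label_blue_inv a'
      rw [k, ha'] at this
      exact M.symm_ne_label _ this.symm
    · intro k
      have := M.label_blue_inv a'
      rw [k, ha', hc] at this
      exact M.symm_ne_label _ this.symm
  · rw [Perm.mul_apply, hd.2, swap_apply_of_ne_of_ne hne hne']

theorem IsDigon.not_sameCycle {β₀ : E} (hd : M.IsDigon β β₀) {a : E} (ha : M.label a = M.label β₀)
    (hne : a ≠ β₀) : ¬ β.SameCycle a β₀ := by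
  intro h
  have := (sameCycle_congr_on (f := β) (g := β) (S := {β₀, M.blue⁻¹ β₀}) (fun z hz => ⟨rfl, ?_⟩)
    (Or.inl rfl) h.symm).2
  · rcases this with k | k
    · exact hne k
    · rw [k, label_blue_inv] at ha
      exact M.symm_ne_label _ ha
  · rcases hz with rfl | hz
    · exact Or.inr hd.1
    · rw [hz]; exact Or.inl hd.2

theorem IsPinched.isDigon_unpinch (h : M.IsPinched B β) {a a' : E}
    (ha' : M.label a' = M.label a) (hne : a' ≠ a) (hd : M.IsDigon β a') :
    M.IsDigon (swap a (β (M.blue⁻¹ a)) * β) a' := by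
  refine hd.swap_mul (h.label_apply_blue_inv a) ha' hne ?_
  intro k
  rw [← hd.2] at k
  exact hne (M.blue⁻¹.injective (β.injective k))

open Classical in
/-- The valid pinched maps in which no face of degree two ends at the free vertex `a` cancel. -/
theorem sum_not_isDigon_eq_zero (hM : M.IsValid M.blue) {A : Finset E} {a : E}
    (ha : a ∈ M.faceSet B) (hfree : M.IsFree B a) (hA : ∀ a' ∈ A, M.label a' = M.label a)
    (haA : a ∉ A) :
    ∑ β ∈ (M.validPerms B).filter (fun β => (∀ a' ∈ A, M.IsDigon β a') ∧ ¬ M.IsDigon β a),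
      permWeight β = 0 := by
  set T := (M.validPerms B).filter (fun β => (∀ a' ∈ A, M.IsDigon β a') ∧ ¬ M.IsDigon β a)
    with hT
  have hmemT : ∀ β, β ∈ T ↔ (M.IsPinched B β ∧ M.IsValid β) ∧
      (∀ a' ∈ A, M.IsDigon β a') ∧ ¬ M.IsDigon β a := fun β => by
    rw [hT, Finset.mem_filter, mem_validPerms]
  -- The sum is fibred over the operation of detaching `a`; `β` is recovered from `φ β` and the
  -- corner `β (M.blue⁻¹ a)`.
  set φ : Perm E → Perm E := fun β => swap a (β (M.blue⁻¹ a)) * β with hφ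
  have hback : ∀ β, β = swap a (β (M.blue⁻¹ a)) * φ β := fun β => by
    rw [hφ]; exact (swap_mul_self_mul _ _ _).symm
  rw [← Finset.sum_fiberwise_of_maps_to (g := φ) (t := T.image φ)
    (fun β hβ => Finset.mem_image_of_mem _ hβ)]
  refine Finset.sum_eq_zero fun β₀ hβ₀ => ?_
  obtain ⟨β₁, hβ₁, e₁⟩ := Finset.mem_image.1 hβ₀
  obtain ⟨⟨hp₁, hv₁⟩, hd₁, hnd₁⟩ := (hmemT β₁).1 hβ₁
  obtain ⟨hp₀, hs₁⟩ := hp₁.unpinch ha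
  have hfix : β₀ (M.blue⁻¹ a) = a := by
    rw [← e₁, hφ]
    simp
  change M.IsPinched B (φ β₁) at hp₀
  change (φ β₁).SameCycle _ _ at hs₁
  have hd₀ : ∀ a' ∈ A, M.IsDigon (φ β₁) a' := fun a' h' =>
    hp₁.isDigon_unpinch (hA a' h') (fun k => haA (k ▸ h')) (hd₁ a' h')
  have hb₁ := hback β₁
  rw [e₁] at hp₀ hs₁ hd₀ hb₁
  have hv₀ : M.IsValid β₀ := by
    rw [hb₁] at hv₁
    exact (hp₀.isValid_swap_mul_iff hM ha hfree hfix hs₁ (hp₁.label_apply_blue_inv a).symm).1 hv₁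
  obtain ⟨m, hm⟩ : ∃ m, Function.minimalPeriod β₀ a = 2 * m := by
    have := even_of_label_pow hp₀.label_apply (a := a) (i := Function.minimalPeriod β₀ a)
      (by rw [pow_period])
    exact this.exists_two_nsmul _ |>.imp fun m hm => by rw [hm, smul_eq_mul]
  have hcyc : ∀ b, β₀.SameCycle a b → M.label b = M.label a →
      ∃ i < m, (β₀ ^ (2 * i)) a = b := by
    intro b hb hl
    obtain ⟨j, hj, rfl⟩ := sameCycle_iff_exists_lt_period.1 hb
    obtain ⟨i, rfl⟩ := (even_of_label_pow hp₀.label_apply hl).exists_two_nsmul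
    rw [smul_eq_mul] at hj ⊢
    exact ⟨i, by omega, rfl⟩
  -- A face of degree two at `a` in `β₀` could not be split further, so `β₁` would already have the
  -- digon at `a`.
  have hm2 : 2 ≤ m := by
    have hpos := period_pos β₀ a
    by_contra hlt
    obtain rfl : m = 1 := by omega
    obtain ⟨i, hi, e⟩ := hcyc _ hs₁ (hp₁.label_apply_blue_inv a)
    obtain rfl : i = 0 := by omega
    have ec : a = β₁ (M.blue⁻¹ a) := e
    rw [← ec, swap_self, ← Perm.one_def, one_mul] at hb₁
    apply hnd₁
    rw [hb₁]
    refine ⟨β₀.injective ?_, hfix⟩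
    rw [hfix]
    have := pow_period β₀ a
    rwa [hm] at this
  -- The fibre consists of all splittings of the face of `a` in `β₀` from `a` to a corner with the
  -- same label, that is, to one at an even position.
  have himage : T.filter (fun β => φ β = β₀) =
      (Finset.range m).image fun i => swap a ((β₀ ^ (2 * i)) a) * β₀ := by
    ext β
    rw [Finset.mem_filter, hmemT, Finset.mem_image]
    constructor
    · rintro ⟨⟨⟨hp, hv⟩, hd, hnd⟩, e⟩
      have hs := (hp.unpinch ha).2
      change (φ β).SameCycle _ _ at hs
      rw [e] at hs
      obtain ⟨i, hi, ei⟩ := hcyc _ hs (hp.label_apply_blue_inv a)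
      refine ⟨i, Finset.mem_range.2 hi, ?_⟩
      rw [ei, ← e]
      exact (hback β).symm
    · rintro ⟨i, hi, rfl⟩
      have hi' := Finset.mem_range.1 hi
      set b := (β₀ ^ (2 * i)) a with hb
      have hs : β₀.SameCycle a b := ⟨(2 * i : ℕ), by rw [zpow_natCast]⟩
      have hl : M.label b = M.label a := by
        rw [hb, label_pow hp₀.label_apply, if_pos (even_two_mul i)]
      have hbp : (swap a b * β₀) (M.blue⁻¹ a) = b := by
        rw [Perm.mul_apply, hfix, swap_apply_left]
      refine ⟨⟨⟨hp₀.swap_mul ha hs hl.symm,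
        (hp₀.isValid_swap_mul_iff hM ha hfree hfix hs hl.symm).2 hv₀⟩, fun a' h' => ?_, ?_⟩, ?_⟩
      · have hne : a' ≠ a := fun k => haA (k ▸ h')
        refine (hd₀ a' h').swap_mul hl (hA a' h') hne ?_
        rintro rfl
        exact (hd₀ _ h').not_sameCycle (hA _ h').symm hne.symm hs
      · intro hd
        have hba : b = a := hbp.symm.trans hd.2
        have h1 := hd.1
        rw [hba, swap_self, ← Perm.one_def, one_mul] at h1
        have h2 : (β₀ ^ 2) a = (β₀ ^ 0) a := by
          rw [pow_two, Perm.mul_apply, h1, hfix]; rfl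
        have := pow_inj_of_lt_period (by omega) (by omega) h2
        omega
      · rw [hφ]
        dsimp only
        rw [hbp, swap_mul_self_mul]
  rw [himage, Finset.sum_image, sum_permWeight_swap_mul hm hm2]
  intro i hi j hj hij
  have hi' : i < m := by simpa using hi
  have hj' : j < m := by simpa using hj
  have := congrArg (fun f : Perm E => f (M.blue⁻¹ a)) hij
  simp only [Perm.mul_apply, hfix, swap_apply_left] at this
  have := pow_inj_of_lt_period (by omega) (by omega) this
  omega

open Classical in
-- Corners are treated one at a time. Since they belong to one partite class, operations at a new
-- corner preserve the digons already imposed.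
theorem sum_eq_sum_isDigon (hM : M.IsValid M.blue) (l : LatticeEdge d) (A : Finset E)
    (hA : ∀ a ∈ A, a ∈ M.faceSet B ∧ M.IsFree B a ∧ M.label a = l) :
    ∑ β ∈ M.validPerms B, permWeight β =
      ∑ β ∈ (M.validPerms B).filter (fun β => ∀ a ∈ A, M.IsDigon β a), permWeight β := by
  induction A using Finset.induction_on with
  | empty => simp
  | insert a A haA ih =>
    obtain ⟨ha, hfree, hl⟩ := hA a (Finset.mem_insert_self _ _)
    rw [ih fun a' h' => hA a' (Finset.mem_insert_of_mem h'),
      ← Finset.sum_filter_add_sum_filter_not _ (fun β => M.IsDigon β a), Finset.filter_filter,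
      Finset.filter_filter, sum_not_isDigon_eq_zero hM ha hfree (fun a' h' => ?_) haA, add_zero]
    · refine Finset.sum_congr (Finset.filter_congr fun β _ => ?_) fun _ _ => rfl
      rw [Finset.forall_mem_insert, and_comm]
    · rw [(hA a' (Finset.mem_insert_of_mem h')).2.2, hl]

/-- After `a` is detached, its face contains `M.blue⁻¹ a`, then `a`; splitting at `M.blue⁻¹ a` and
the successor of `a` cuts off the digon. -/
theorem exists_isDigon (l : LatticeEdge d) (A : Finset E)
    (hA : ∀ a ∈ A, a ∈ M.faceSet B ∧ M.label a = l) :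
    ∃ β, M.IsPinched B β ∧ ∀ a ∈ A, M.IsDigon β a := by
  induction A using Finset.induction_on with
  | empty => exact ⟨M.blue, isPinched_blue M B, by simp⟩
  | insert a A haA ih =>
    obtain ⟨β₁, h₁, hd₁⟩ := ih fun a' h' => hA a' (Finset.mem_insert_of_mem h')
    obtain ⟨ha, hl⟩ := hA a (Finset.mem_insert_self _ _)
    have hlA : ∀ a' ∈ A, M.label a' = M.label a := fun a' h' => by
      rw [hl, (hA a' (Finset.mem_insert_of_mem h')).2]
    have h₀ := (h₁.unpinch ha).1
    have hd₀ : ∀ a' ∈ A, M.IsDigon (swap a (β₁ (M.blue⁻¹ a)) * β₁) a' := fun a' h' =>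
      h₁.isDigon_unpinch (hlA a' h') (fun k => haA (k ▸ h')) (hd₁ a' h')
    have hfix : (swap a (β₁ (M.blue⁻¹ a)) * β₁) (M.blue⁻¹ a) = a := by simp
    set β₀ := swap a (β₁ (M.blue⁻¹ a)) * β₁
    have hlβ : M.label (β₀ a) = (M.label a).symm := h₀.label_apply a
    have hlp := M.label_blue_inv a
    have hs : β₀.SameCycle (M.blue⁻¹ a) (β₀ a) := by
      have h1 := sameCycle_apply_self β₀ (M.blue⁻¹ a)
      rw [hfix] at h1
      exact h1.trans (sameCycle_apply_self _ _)
    have hneq : ∀ a' z, M.label a' = M.label a → M.label z = (M.label a).symm → a' ≠ z := by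
      rintro a' z h h' rfl
      exact M.symm_ne_label a (h'.symm.trans h)
    refine ⟨swap (M.blue⁻¹ a) (β₀ a) * β₀,
      h₀.swap_mul (blue_inv_mem_faceSet.2 ha) hs (hlp.trans hlβ.symm), ?_⟩
    rw [Finset.forall_mem_insert]
    refine ⟨⟨?_, ?_⟩, fun a' h' => ⟨?_, ?_⟩⟩
    · rw [Perm.mul_apply, swap_apply_right]
    · rw [Perm.mul_apply, hfix, swap_apply_of_ne_of_ne (hneq _ _ rfl hlp) (hneq _ _ rfl hlβ)]
    · have hne : a' ≠ a := fun k => haA (k ▸ h')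
      rw [Perm.mul_apply, (hd₀ a' h').1, swap_apply_of_ne_of_ne]
      · exact fun k => hne (M.blue⁻¹.injective k)
      · rw [← (hd₀ a' h').1]
        exact fun k => hne (β₀.injective k)
    · rw [Perm.mul_apply, (hd₀ a' h').2, swap_apply_of_ne_of_ne (hneq _ _ (hlA a' h') hlp)
        (hneq _ _ (hlA a' h') hlβ)]

/-! ### Evaluation of the sum -/

theorem permWeight_of_period_two (hβ : M.IsPinched B β)
    (h2 : ∀ x ∈ M.faceSet B, β (β x) = x) :
    permWeight β = ∏ F ∈ Finset.univ.erase B, signedCatalan (F.size / 2) := by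
  classical
  set S : Finset E := Finset.univ.filter fun x => x ∈ M.faceSet B with hS
  have hmem : ∀ x, x ∈ S ↔ x ∈ M.faceSet B := fun x => by simp [hS]
  rw [permWeight_split (f := β) (S := S) fun x hx =>
    (hmem _).2 (hβ.apply_mem.2 ((hmem _).1 hx))]
  have h1 : ∏ s ∈ S.image (cycleFinset β), signedCatalan (s.card / 2) = 1 := by
    refine Finset.prod_eq_one fun s hs => ?_
    obtain ⟨x, hx, rfl⟩ := Finset.mem_image.1 hs
    have hx2 := h2 x ((hmem x).1 hx)
    have : Function.minimalPeriod β x = 2 := by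
      refine Function.minimalPeriod_eq_prime (p := 2) (hx2 : Function.IsPeriodicPt β 2 x)
        fun k => ?_
      have hl := hβ.label_apply x
      rw [show β x = x from k] at hl
      exact M.symm_ne_label x hl.symm
    rw [card_cycleFinset, this]
    exact signedCatalan_one
  rw [h1, one_mul, prod_orbits M.blue (Finset.univ.erase B) fun k => signedCatalan (k / 2)]
  have h3 : Sᶜ.image (cycleFinset β) = Sᶜ.image (cycleFinset M.blue) := by
    refine Finset.image_congr fun x hx => ?_
    refine cycleFinset_congr (S := (M.faceSet B)ᶜ) (fun z hz => ⟨hβ.off z hz, fun k =>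
      hz (hβ.apply_mem.1 k)⟩) fun k => ?_
    exact Finset.mem_compl.1 (Finset.mem_coe.1 hx) ((hmem x).2 k)
  rw [h3]
  congr 1
  ext s
  simp only [Finset.mem_image, Finset.mem_compl, Finset.mem_erase, Finset.mem_univ, and_true,
    hmem]
  constructor
  · rintro ⟨x, hx, rfl⟩
    exact ⟨_, hx, rfl⟩
  · rintro ⟨F, hF, rfl⟩
    obtain ⟨x, rfl⟩ := Quotient.exists_rep F
    exact ⟨x, hF, rfl⟩

/-- The sum of the weights when nothing is connected outside `B`. -/
theorem sum_validPerms_of_forall_isFree (hM : M.IsValid M.blue)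
    (hfree : ∀ a ∈ M.faceSet B, M.IsFree B a) :
    ∑ β ∈ M.validPerms B, permWeight β =
      ∏ F ∈ Finset.univ.erase B, signedCatalan (F.size / 2) := by
  classical
  obtain ⟨o, ho⟩ : ∃ o, o ∈ M.faceSet B := Quotient.exists_rep B
  set A : Finset E := Finset.univ.filter fun a => a ∈ M.faceSet B ∧ M.label a = M.label o with hA
  have hmemA : ∀ a, a ∈ A ↔ a ∈ M.faceSet B ∧ M.label a = M.label o := fun a => by simp [hA]
  -- Each edge of `B` either starts or ends at a corner of the chosen class, so the digons prescribe
  -- `β` on all of `B`.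
  have hval : ∀ β, (∀ a ∈ A, M.IsDigon β a) → ∀ x ∈ M.faceSet B,
      (M.label x = M.label o ∧ β x = M.blue⁻¹ x) ∨
        (M.label x ≠ M.label o ∧ β x = M.blue x) ∧ M.label (M.blue x) = M.label o := by
    intro β hβ x hx
    rcases label_eq_or_symm_of_mem ho hx with hl | hl
    · exact Or.inl ⟨hl, (hβ x ((hmemA x).2 ⟨hx, hl⟩)).1⟩
    · have hl' : M.label (M.blue x) = M.label o := by
        rw [M.label_blue, hl, SimpleGraph.Dart.symm_symm]
      have hd := (hβ _ ((hmemA _).2 ⟨blue_mem_faceSet.2 hx, hl'⟩)).2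
      rw [show M.blue⁻¹ (M.blue x) = x from M.blue.symm_apply_apply x] at hd
      exact Or.inr ⟨⟨fun k => M.symm_ne_label o (hl.symm.trans k), hd⟩, hl'⟩
  obtain ⟨β, hβ, hd⟩ := exists_isDigon (M := M) (B := B) (M.label o) A fun a ha => (hmemA a).1 ha
  have hsingle : (M.validPerms B).filter (fun β => ∀ a ∈ A, M.IsDigon β a) = {β} := by
    ext γ
    rw [Finset.mem_filter, mem_validPerms, Finset.mem_singleton]
    constructor
    · rintro ⟨⟨hγ, -⟩, hdγ⟩
      ext x
      by_cases hx : x ∈ M.faceSet B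
      · rcases hval γ hdγ x hx with h | h <;> rcases hval β hd x hx with h' | h'
        · rw [h.2, h'.2]
        · exact (h'.1.1 h.1).elim
        · exact (h.1.1 h'.1).elim
        · rw [h.1.2, h'.1.2]
      · rw [hγ.off x hx, hβ.off x hx]
    · rintro rfl
      exact ⟨⟨hβ, hβ.isValid_of_forall_isFree hM ho hfree⟩, hd⟩
  rw [sum_eq_sum_isDigon hM (M.label o) A fun a ha =>
    ⟨((hmemA a).1 ha).1, hfree a ((hmemA a).1 ha).1, ((hmemA a).1 ha).2⟩, hsingle,
    Finset.sum_singleton]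
  refine permWeight_of_period_two hβ fun x hx => ?_
  rcases hval β hd x hx with h | h
  · rw [h.2]
    exact (hd x ((hmemA x).2 ⟨hx, h.1⟩)).2
  · rw [h.1.2, (hd _ ((hmemA _).2 ⟨blue_mem_faceSet.2 hx, h.2⟩)).1]
    exact M.blue.symm_apply_apply x

/-- The sum of the weights vanishes as soon as two vertices of `B` are connected outside `B`. -/
theorem sum_validPerms_eq_zero (hp : PlanarPair M.blue M.yellow) (hM : M.IsValid M.blue)
    (hex : ∃ u v, M.IsOuterPair B u v) : ∑ β ∈ M.validPerms B, permWeight β = 0 := by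
  classical
  -- The outer pair is chosen at minimal distance `k` along `B`.
  have hQ : ∃ k u, 0 < k ∧ k < Function.minimalPeriod M.blue u ∧
      M.IsOuterPair B u ((M.blue ^ k) u) := by
    obtain ⟨u, v, h⟩ := hex
    obtain ⟨k, hk, rfl⟩ := sameCycle_iff_exists_lt_period.1 (sameCycle_of_mem h.1 h.2.1)
    exact ⟨k, u, Nat.pos_of_ne_zero fun k0 => h.2.2.1 (by rw [k0]; rfl), hk, h⟩
  obtain ⟨u, hk0, hkN, huv⟩ := Nat.find_spec hQ
  have hmin : ∀ j, j < Nat.find hQ → ¬ ∃ u, 0 < j ∧ j < Function.minimalPeriod M.blue u ∧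
      M.IsOuterPair B u ((M.blue ^ j) u) := fun j hj => Nat.find_min hQ hj
  set k := Nat.find hQ
  set N := Function.minimalPeriod M.blue u
  have hlk : M.label u = M.label ((M.blue ^ k) u) := huv.label_eq hp hM
  have hkeven : Even k := even_of_label_pow M.label_blue hlk.symm
  have hmemB : ∀ i : ℕ, (M.blue ^ i) u ∈ M.faceSet B := fun i =>
    (mem_faceSet_iff huv.1).2 ⟨i, by rw [zpow_natCast]⟩
  have hper : ∀ i : ℕ, Function.minimalPeriod M.blue ((M.blue ^ i) u) = N := fun i => by
    rw [← Perm.iterate_eq_pow]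
    exact Function.minimalPeriod_apply_iterate (M.blue.injective.mem_periodicPts u) i
  have hadd : ∀ i j : ℕ, i ≤ j → (M.blue ^ (j - i)) ((M.blue ^ i) u) = (M.blue ^ j) u := by
    intro i j hij
    rw [← Perm.mul_apply, ← pow_add, Nat.sub_add_cancel hij]
  -- An outer pair starting at an opposite-class corner between `u` and the end of the arc cannot
  -- cross the chosen one, so it would lie within the arc and be closer.
  have hfree : ∀ i, i < k → ¬ Even i → M.IsFree B ((M.blue ^ i) u) := by
    intro i hi hodd
    refine isFree_of_forall_not_isOuterPair (hmemB i) fun w hw => ?_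
    have hl : M.label u ≠ M.label ((M.blue ^ i) u) := by
      rw [label_pow M.label_blue, if_neg hodd]
      exact (M.symm_ne_label u).symm
    have hside := huv.not_cross hp hM hw hl
    obtain ⟨j, hj, rfl⟩ := sameCycle_iff_exists_lt_period.1 (sameCycle_of_mem huv.1 hw.2.1)
    have hiff := sameCycle_swap_mul_pow_pow_iff (f := M.blue) (o := u) (i := 0) hk0 hkN
      (k := i) (l := j) (by omega) hj
    rw [pow_zero, Perm.one_apply] at hiff
    have hjk : j < k := ((hiff.1 hside).1 ⟨Nat.zero_le _, hi⟩).2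
    rcases lt_trichotomy i j with hij | rfl | hij
    · refine hmin (j - i) (by omega) ⟨(M.blue ^ i) u, by omega, by rw [hper]; omega, ?_⟩
      rwa [hadd i j hij.le]
    · exact hw.2.2.1 rfl
    · refine hmin (i - j) (by omega) ⟨(M.blue ^ j) u, by omega, by rw [hper]; omega, ?_⟩
      rw [hadd j i hij.le]
      exact hw.symm
  set A : Finset E := ((Finset.range k).filter fun i => ¬ Even i).image fun i => (M.blue ^ i) u
    with hA
  rw [sum_eq_sum_isDigon hM (M.label u).symm A]
  · rw [Finset.filter_eq_empty_iff.2, Finset.sum_empty]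
    intro β hβ hd
    obtain ⟨hpin, hval⟩ := mem_validPerms.1 hβ
    refine huv.not_isValid hp hM hpin ?_ hval
    -- A digon at position `2i + 1` identifies the corners at positions `2i` and `2i + 2`; chaining
    -- them identifies the outer pair.
    have hchain : ∀ i, 2 * i ≤ k → (β * M.blue⁻¹).SameCycle u ((M.blue ^ (2 * i)) u) := by
      intro i
      induction i with
      | zero => exact fun _ => Perm.SameCycle.refl _ _
      | succ i ih =>
        intro hi
        refine (ih (by omega)).trans ?_
        have hdi := (hd ((M.blue ^ (2 * i + 1)) u) (Finset.mem_image_of_mem _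
          (Finset.mem_filter.2 ⟨Finset.mem_range.2 (by omega), by
            rw [Nat.not_even_iff_odd]; exact ⟨i, rfl⟩⟩))).1
        have e1 : ∀ j, M.blue⁻¹ ((M.blue ^ (j + 1)) u) = (M.blue ^ j) u := fun j => by
          rw [pow_succ', Perm.mul_apply]
          exact M.blue.symm_apply_apply _
        rw [e1] at hdi
        have := sameCycle_apply_self (β * M.blue⁻¹) ((M.blue ^ (2 * (i + 1))) u)
        rw [Perm.mul_apply, show 2 * (i + 1) = 2 * i + 1 + 1 by ring, e1, hdi] at this
        rw [show 2 * (i + 1) = 2 * i + 1 + 1 by ring]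
        exact this.symm
    obtain ⟨i, hi⟩ := hkeven.exists_two_nsmul
    rw [smul_eq_mul] at hi
    rw [hi]
    exact hchain i hi.ge
  · intro a ha
    obtain ⟨i, hi, rfl⟩ := Finset.mem_image.1 ha
    obtain ⟨hi, hodd⟩ := Finset.mem_filter.1 hi
    refine ⟨hmemB i, hfree i (Finset.mem_range.1 hi) hodd, ?_⟩
    rw [label_pow M.label_blue, if_neg hodd]

/-- The single pinching of the pair already suffices; its vertex permutation is the transposition of
`u` and `v`. -/
theorem IsOuterPair.exists_invalid (hp : PlanarPair M.blue M.yellow) (hM : M.IsValid M.blue)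
    {u v : E} (h : M.IsOuterPair B u v) : (M.invalidPinchings B).Nonempty := by
  have hpin := (isPinched_blue M B).swap_mul h.1 (sameCycle_of_mem h.1 h.2.1) (h.label_eq hp hM)
  obtain ⟨P, hP⟩ := hpin.exists_perform
  refine ⟨P, fun hns => ?_⟩
  rw [perform_nonSeparable_iff, hP] at hns
  refine h.not_isValid hp hM hpin ?_ hns
  rw [mul_assoc, mul_inv_cancel, mul_one]
  exact ⟨1, by rw [zpow_one, swap_apply_left]⟩

end EmbeddedMap

end SurfaceSum

open SurfaceSum EmbeddedMap in
theorem theorem6p2 {d n : ℕ} {E : Type*} [Fintype E] [DecidableEq E]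
    (s : Fin n → SurfaceSum.LatticeLoop d) (K : SurfaceSum.Plaquette d → ℕ)
    (M : SurfaceSum.EmbeddedMap d n E) (hM : M.IsNPM s K) (B : M.BlueFace) :
    (M.invalidPinchings B = ∅ →
      ∑ m ∈ (M.validMaps_finite B).toFinset, m.weight =
        ∏ F ∈ Finset.univ.erase B, SurfaceSum.signedCatalan (F.size / 2)) ∧
    ((M.invalidPinchings B).Nonempty →
      ∑ m ∈ (M.validMaps_finite B).toFinset, m.weight = 0) := by
  have hp := hM.planar.planarPair
  have hv := M.nonSeparable_iff.1 hM.nonSeparable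
  rw [sum_validMaps hM.planar hv]
  -- The existence of an outer pair is equivalent to that of an invalid collection, so each side of
  -- this alternative settles one conclusion and rules out the hypothesis of the other.
  by_cases hex : ∃ u v, M.IsOuterPair B u v
  · refine ⟨fun h => ?_, fun _ => sum_validPerms_eq_zero hp hv hex⟩
    obtain ⟨u, v, huv⟩ := hex
    exact ((huv.exists_invalid hp hv).ne_empty h).elim
  · push Not at hex
    have hfree : ∀ a ∈ M.faceSet B, M.IsFree B a := fun a ha =>
      isFree_of_forall_not_isOuterPair ha (hex a)
    refine ⟨fun _ => sum_validPerms_of_forall_isFree hv hfree, ?_⟩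
    rintro ⟨P, hP⟩
    obtain ⟨o, ho⟩ : ∃ o, o ∈ M.faceSet B := Quotient.exists_rep B
    exact (hP ((perform_nonSeparable_iff P).2
      ((isPinched_perform P).isValid_of_forall_isFree hv ho hfree))).elim
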